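/- For a positive integer $r$, let $\mathrm{Kostka}_r\subset\mathbb{R}^{2r}$ be the convex hull of all integer points $(\lambda_1,\dots,\lambda_r,\mu_1,\dots,\mu_r)$ such that $\lambda=(\lambda_1\ge\dots\ge\lambda_r\ge 0)$ and $\mu=(\mu_1\ge\dots\ge\mu_r\ge 0)$ are partitions of the same integer $n\ge 0$ and $\lambda$ dominates $\mu$, i.e. $\sum_{i\le k}\lambda_i\ge\sum_{i\le k}\mu_i$ for all $k\le r$. Let $P_r=\mathrm{Kostka}_r\cap\{\sum_{i=1}^r(\lambda_i+\mu_i)=1\}$, and let $f_d(r)$ denote the number of $d$-dimensional faces of the polytope $P_r$ (the polytope itself counts as a face; for $r=0$ put $f_d(0)=0$). Fix an integer $d\ge 0$ and set $d_{\min}=\left\lfloor\frac{d+3}{2}\right\rfloor$. Then each $f_d(r)$ is finite, and $f_d$ is a polynomial in $r$ of degree at most $3d+3$. Moreover there are nonnegative integers $\alpha_k$, $d_{\min}\le k\le 3d+3$, such that for all $r\ge 0$ $$f_d(r)=\sum_{k=d_{\min}}^{3d+3}\alpha_k\binom{r}{k}.$$ These coefficients satisfy the recursion $$\alpha_k=f_d(k)-\sum_{j=d_{\min}}^{k-1}\binom{k}{j}\alpha_j\qquad(d_{\min}<k\le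 3d+3),$$ with initial value $$\alpha_{d_{\min}}=f_d(d_{\min})=\begin{cases}3d_{\min}-2&\text{if } d \text{ is odd and } d>1,\\ 1&\text{if } d\text{ is even},\\ 3&\text{if } d=1.\end{cases}$$ -/

import Mathlib

/-- Partitions of `n` into at most `r` parts, written as non-increasing `r`-tuples of
nonnegative integers. -/
def partitionTuples (r n : ℕ) : Set (Fin r → ℕ) :=
  {lam | Antitone lam ∧ ∑ i, lam i = n}

/-- Dominance order: every partial sum of `lam` is at least the corresponding partial sum
of `mu`. -/
def Dominates {r : ℕ} (lam mu : Fin r → ℕ) : Prop :=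
  ∀ k : Fin r, ∑ i ∈ Finset.Iic k, mu i ≤ ∑ i ∈ Finset.Iic k, lam i

/-- The integer points `(lam, mu)` of `ℝ^r × ℝ^r = ℝ^(2r)`, where `lam` and `mu` are partitions of
the same `n` into at most `r` parts and `lam` dominates `mu`. The empty partition (`n = 0`) is
allowed, so that the convex hull below is a cone with apex at the origin. -/
def kostkaPoints (r : ℕ) : Set ((Fin r → ℝ) × (Fin r → ℝ)) :=
  {x | ∃ (n : ℕ) (lam mu : Fin r → ℕ), lam ∈ partitionTuples r n ∧ mu ∈ partitionTuples r n ∧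
    Dominates lam mu ∧ x = (fun i => (lam i : ℝ), fun i => (mu i : ℝ))}

/-- The `r`-Kostka cone. -/
def kostkaCone (r : ℕ) : Set ((Fin r → ℝ) × (Fin r → ℝ)) :=
  convexHull ℝ (kostkaPoints r)

/-- The `r`-Kostka polytope: the slice of the cone on which all coordinates sum to `1`. -/
def kostkaPolytope (r : ℕ) : Set ((Fin r → ℝ) × (Fin r → ℝ)) :=
  kostkaCone r ∩ {x | ∑ i, (x.1 i + x.2 i) = 1}

/-- The `d`-dimensional faces of the `r`-Kostka polytope: the nonempty sets of maximizers of a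
linear functional on the polytope (the polytope itself included, via the zero functional) whose
affine span has dimension `d`. -/
def kostkaFaces (d r : ℕ) : Set (Set ((Fin r → ℝ) × (Fin r → ℝ))) :=
  {F | F.Nonempty ∧ IsExposed ℝ (kostkaPolytope r) F ∧
    Module.finrank ℝ (vectorSpan ℝ F) = d}

/-- The number `f_d(r)` of `d`-dimensional faces of the `r`-Kostka polytope. -/
noncomputable def kostkaFaceNumber (d r : ℕ) : ℕ := (kostkaFaces d r).ncard

/-! Write a_n and b_n for the gaps of lam and mu, and κ_n for the surplus after n entries. Inside
the hyperplane κ_r = 0 the convex hull is the polyhedral cone a, b, κ ≥ 0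
(`kostkaCone_eq_polyCone`). A face of the slice is therefore recorded by the set of forms that are
positive at a relative interior point, and the faces correspond to the sign patterns of nonzero
points (`kostkaFaces_eq_image`).

One identity decides which patterns occur: b_n - a_n = κ_n - 2κ_{n+1} + κ_{n+2}. A maximal run of
positive surpluses must contain a positive a, since otherwise κ would be convex there with zeros at
both ends; where κ_{n+1} = 0, b_n is positive exactly when a_n or a neighbouring surplus is. These
conditions, checked by the three-state automaton `signStep`, are also sufficient: pairs lam = mu
with one unit gap, and pairs with a tent-shaped surplus, realize every positive sign of an accepted
word. A discrete Dirichlet problem shows that the positive a's and those positive b's that sit at a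
positive surplus are free coordinates on the span of a face, so that its dimension is a sum of
letter weights (`finrank_faceSpace_kostka`).

A letter with a = b = 0 has weight zero, has exactly one legal form in each state and leaves the
state unchanged. So an accepted word of length r amounts to an accepted word of k other letters
together with their k positions. This gives the binomial expansion (`signCount_eq_sum`), whose
coefficients count words of weight d + 1 and hence do not depend on r. Bounds on the weight of such
words confine k, and counting the heaviest ones gives the initial value. The recursion is the
expansion read at r = k. -/

/-! ### Faces of a slice of a polyhedral cone -/

section Polyhedral

variable {V ι : Type*} [AddCommGroup V] [Module ℝ V]

/-- The cone in the subspace `W` cut out by the inequalities `0 ≤ g m`. -/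
def polyCone (W : Submodule ℝ V) (g : ι → V →ₗ[ℝ] ℝ) : Set V :=
  {x | x ∈ W ∧ ∀ m, 0 ≤ g m x}

/-- The part of the slice `s = 1` of the cone on which the functionals outside `τ` vanish. -/
def sliceFace (W : Submodule ℝ V) (s : V →ₗ[ℝ] ℝ) (g : ι → V →ₗ[ℝ] ℝ) (τ : ι → Prop) : Set V :=
  {x | (x ∈ polyCone W g ∧ s x = 1) ∧ ∀ m, ¬ τ m → g m x = 0}

/-- The subspace of `W` on which the functionals outside `τ` vanish. -/
def faceSpace (W : Submodule ℝ V) (g : ι → V →ₗ[ℝ] ℝ) (τ : ι → Prop) : Submodule ℝ V where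
  carrier := {x | x ∈ W ∧ ∀ m, ¬ τ m → g m x = 0}
  add_mem' := by
    rintro x y ⟨hx, hx'⟩ ⟨hy, hy'⟩
    exact ⟨W.add_mem hx hy, fun m hm => by rw [map_add, hx' m hm, hy' m hm, add_zero]⟩
  zero_mem' := ⟨W.zero_mem, fun m _ => map_zero _⟩
  smul_mem' := by
    rintro t x ⟨hx, hx'⟩
    exact ⟨W.smul_mem t hx, fun m hm => by rw [map_smul, hx' m hm, smul_zero]⟩

variable {W : Submodule ℝ V} {s : V →ₗ[ℝ] ℝ} {g : ι → V →ₗ[ℝ] ℝ}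

theorem mem_faceSpace {τ : ι → Prop} {x : V} :
    x ∈ faceSpace W g τ ↔ x ∈ W ∧ ∀ m, ¬ τ m → g m x = 0 := Iff.rfl

theorem polyCone_add_mem {x y : V} (hx : x ∈ polyCone W g) (hy : y ∈ polyCone W g) :
    x + y ∈ polyCone W g :=
  ⟨W.add_mem hx.1 hy.1, fun m => by rw [map_add]; exact add_nonneg (hx.2 m) (hy.2 m)⟩

theorem polyCone_smul_mem {x : V} (hx : x ∈ polyCone W g) {t : ℝ} (ht : 0 ≤ t) :
    t • x ∈ polyCone W g :=
  ⟨W.smul_mem t hx.1, fun m => by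
    rw [map_smul, smul_eq_mul]; exact mul_nonneg ht (hx.2 m)⟩

theorem polyCone_convex : Convex ℝ (polyCone W g) := fun _ hx _ hy _ _ ha hb _ =>
  polyCone_add_mem (polyCone_smul_mem hx ha) (polyCone_smul_mem hy hb)

/-- A small step from a point of the cone in a direction of the linear span of its face stays
inside the cone. -/
theorem exists_step_mem_polyCone [Finite ι] {x v : V} (hx : x ∈ polyCone W g)
    (hv : v ∈ faceSpace W g (fun m => 0 < g m x)) :
    ∃ t : ℝ, 0 < t ∧ x + t • v ∈ polyCone W g := by
  have key : ∀ m, ∃ t : ℝ, 0 < t ∧ ∀ u, 0 ≤ u → u ≤ t → 0 ≤ g m x + u * g m v := by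
    intro m
    rcases (hx.2 m).lt_or_eq with h | h
    · refine ⟨g m x / (|g m v| + 1), by positivity, fun u hu hut => ?_⟩
      rw [le_div_iff₀ (by positivity)] at hut
      have h1 : -(u * |g m v|) ≤ u * g m v := by
        have := mul_le_mul_of_nonneg_left (neg_abs_le (g m v)) hu
        linarith
      linarith
    · refine ⟨1, one_pos, fun u _ _ => ?_⟩
      have := hv.2 m (show ¬ 0 < g m x by rw [← h]; exact lt_irrefl _)
      rw [this, ← h]; simp
  choose t ht ht' using key
  obtain ⟨u, hu, hut⟩ : ∃ u : ℝ, 0 < u ∧ ∀ m, u ≤ t m := by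
    rcases isEmpty_or_nonempty ι with h | h
    · exact ⟨1, one_pos, fun m => (h.false m).elim⟩
    · obtain ⟨m, hm⟩ := Finite.exists_min t
      exact ⟨t m, ht m, hm⟩
  refine ⟨u, hu, W.add_mem hx.1 (W.smul_mem _ hv.1), fun m => ?_⟩
  rw [map_add, map_smul, smul_eq_mul]
  exact ht' m u hu.le (hut m)

/-- Each point lies in its own face, hence in that of the other, which bounds its support by the
support of the other. -/
theorem sliceFace_sign_injOn {x y : V} (hx : x ∈ polyCone W g) (hy : y ∈ polyCone W g)
    (hxs : s x = 1) (hys : s y = 1)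
    (h : sliceFace W s g (fun m => 0 < g m x) = sliceFace W s g (fun m => 0 < g m y)) (m : ι) :
    0 < g m x ↔ 0 < g m y := by
  have aux : ∀ z : V, z ∈ polyCone W g → s z = 1 →
      z ∈ sliceFace W s g (fun m => 0 < g m z) := fun z hz hz1 =>
    ⟨⟨hz, hz1⟩, fun m hm => le_antisymm (not_lt.1 hm) (hz.2 m)⟩
  have h1 : x ∈ sliceFace W s g (fun m => 0 < g m y) := h ▸ aux x hx hxs
  have h2 : y ∈ sliceFace W s g (fun m => 0 < g m x) := h ▸ aux y hy hys
  constructor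
  · intro hm; by_contra hn; exact hm.ne' (h1.2 m hn)
  · intro hm; by_contra hn; exact hm.ne' (h2.2 m hn)

/-- The point `x` is relatively interior: a small step in any direction allowed by the equations
stays in the face. -/
theorem vectorSpan_sliceFace [Finite ι] {x : V} (hx : x ∈ polyCone W g) (hxs : s x = 1) :
    vectorSpan ℝ (sliceFace W s g (fun m => 0 < g m x)) =
      faceSpace W g (fun m => 0 < g m x) ⊓ LinearMap.ker s := by
  apply le_antisymm
  · rw [vectorSpan_def, Submodule.span_le]
    rintro _ ⟨y, hy, z, hz, rfl⟩
    refine ⟨⟨W.sub_mem hy.1.1.1 hz.1.1.1, fun m hm => ?_⟩, ?_⟩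
    · simp [hy.2 m hm, hz.2 m hm]
    · simp [hy.1.2, hz.1.2]
  · rintro v ⟨hv, hvs⟩
    obtain ⟨t, ht, hmem⟩ := exists_step_mem_polyCone hx hv
    have hvs' : s v = 0 := hvs
    have h1 : x + t • v ∈ sliceFace W s g (fun m => 0 < g m x) := by
      refine ⟨⟨hmem, by simp [hxs, hvs']⟩, fun m hm => ?_⟩
      rw [map_add, map_smul, hv.2 m hm, le_antisymm (not_lt.1 hm) (hx.2 m)]; simp
    have h2 : x ∈ sliceFace W s g (fun m => 0 < g m x) :=
      ⟨⟨hx, hxs⟩, fun m hm => le_antisymm (not_lt.1 hm) (hx.2 m)⟩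
    have h3 := vsub_mem_vectorSpan ℝ h1 h2
    rw [vsub_eq_sub, add_sub_cancel_left] at h3
    simpa [smul_smul, inv_mul_cancel₀ ht.ne'] using Submodule.smul_mem _ t⁻¹ h3

theorem finrank_vectorSpan_sliceFace [Finite ι] [FiniteDimensional ℝ V] {x : V}
    (hx : x ∈ polyCone W g) (hxs : s x = 1) :
    Module.finrank ℝ (vectorSpan ℝ (sliceFace W s g (fun m => 0 < g m x))) + 1 =
      Module.finrank ℝ (faceSpace W g (fun m => 0 < g m x)) := by
  rw [vectorSpan_sliceFace hx hxs]
  set E := faceSpace W g (fun m => 0 < g m x) with hE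
  have hxE : x ∈ E := ⟨hx.1, fun m hm => le_antisymm (not_lt.1 hm) (hx.2 m)⟩
  have h := LinearMap.finrank_range_add_finrank_ker (s.domRestrict E)
  have hr : LinearMap.range (s.domRestrict E) = ⊤ := by
    rw [LinearMap.range_eq_top]
    intro t
    exact ⟨t • ⟨x, hxE⟩, by simp [hxs]⟩
  have hk : Module.finrank ℝ (LinearMap.ker (s.domRestrict E)) =
      Module.finrank ℝ (E ⊓ LinearMap.ker s : Submodule ℝ V) := by
    rw [LinearMap.ker_domRestrict, ← Submodule.map_comap_subtype,
      Submodule.finrank_map_subtype_eq]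
  rw [hr, finrank_top, Module.finrank_self] at h
  omega

open scoped Pointwise in
/-- A pointed cone is the convex hull of a set `G` of its points that is closed under multiples,
as soon as the support of every nonzero point of the cone contains that of a point of `G`. -/
theorem polyCone_subset_convexHull [Finite ι] {G : Set V} (h0 : (0 : V) ∈ G)
    (hmul : ∀ (n : ℕ), ∀ v ∈ G, (n : ℝ) • v ∈ G) (hG : G ⊆ polyCone W g)
    (hpt : ∀ x ∈ W, (∀ m, g m x = 0) → x = 0)
    (hgen : ∀ x ∈ polyCone W g, ∀ m, 0 < g m x →
      ∃ v ∈ G, 0 < g m v ∧ ∀ m', 0 < g m' v → 0 < g m' x) :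
    polyCone W g ⊆ convexHull ℝ G := by
  classical
  have : Fintype ι := Fintype.ofFinite ι
  have hnat : ∀ (n : ℕ), ∀ v ∈ convexHull ℝ G, (n : ℝ) • v ∈ convexHull ℝ G := by
    intro n v hv
    have h1 : (n : ℝ) • v ∈ (n : ℝ) • convexHull ℝ G := Set.smul_mem_smul_set hv
    rw [← convexHull_smul] at h1
    refine convexHull_mono ?_ h1
    rintro _ ⟨w, hw, rfl⟩
    exact hmul n w hw
  have h0' : (0 : V) ∈ convexHull ℝ G := subset_convexHull ℝ G h0
  have hconv := convex_convexHull ℝ G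
  have hsmul : ∀ t : ℝ, 0 ≤ t → ∀ v ∈ convexHull ℝ G, t • v ∈ convexHull ℝ G := by
    intro t ht v hv
    obtain ⟨n, hn⟩ := exists_nat_gt t
    have hn0 : (0 : ℝ) < n := ht.trans_lt hn
    have h1 := hnat n _ (hconv.smul_mem_of_zero_mem h0' hv
      (t := t / n) ⟨by positivity, (div_le_one hn0).2 hn.le⟩)
    rwa [smul_smul, mul_div_cancel₀ _ hn0.ne'] at h1
  have hadd : ∀ v ∈ convexHull ℝ G, ∀ w ∈ convexHull ℝ G, v + w ∈ convexHull ℝ G := by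
    intro v hv w hw
    have h1 := hsmul 2 (by norm_num) _
      (hconv hv hw (a := 1 / 2) (b := 1 / 2) (by norm_num) (by norm_num) (by norm_num))
    rw [smul_add, smul_smul, smul_smul] at h1
    norm_num at h1
    exact h1
  have main : ∀ (n : ℕ) (x : V), x ∈ polyCone W g →
      (Finset.univ.filter fun m => 0 < g m x).card = n → x ∈ convexHull ℝ G := by
    intro n
    induction n using Nat.strong_induction_on with
    | _ n ih =>
      intro x hx hn
      by_cases hne : ∃ m, 0 < g m x
      · obtain ⟨m, hm⟩ := hne
        obtain ⟨v, hvG, hvm, hv⟩ := hgen x hx m hm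
        -- The least ratio is the largest multiple of `v` that can be subtracted within the cone.
        -- Subtracting it annihilates form `k`, so the support shrinks and the induction applies.
        obtain ⟨k, hk, hmin⟩ := (Finset.univ.filter fun m => 0 < g m v).exists_min_image
          (fun m => g m x / g m v) ⟨m, by simpa using hvm⟩
        have hkv : 0 < g k v := by simpa using hk
        set t := g k x / g k v with ht
        have ht0 : 0 < t := div_pos (hv k hkv) hkv
        have hgy : ∀ m', g m' (x - t • v) = g m' x - t * g m' v := fun m' => by simp
        have hy : x - t • v ∈ polyCone W g := by
          refine ⟨W.sub_mem hx.1 (W.smul_mem _ (hG hvG).1), fun m' => ?_⟩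
          rw [hgy]
          rcases ((hG hvG).2 m').lt_or_eq with h | h
          · have := hmin m' (by simpa using h)
            rw [le_div_iff₀ h] at this
            linarith
          · rw [← h]; simpa using hx.2 m'
        have hlt : (Finset.univ.filter fun m => 0 < g m (x - t • v)).card < n := by
          rw [← hn]
          refine Finset.card_lt_card ⟨fun m' hm' => ?_, fun hsub => ?_⟩
          · simp only [Finset.mem_filter, Finset.mem_univ, true_and, hgy] at hm' ⊢
            have := mul_nonneg ht0.le ((hG hvG).2 m')
            linarith
          · have h1 : k ∈ Finset.univ.filter fun m => 0 < g m x := by simpa using hv k hkv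
            have h2 := hsub h1
            simp only [Finset.mem_filter, Finset.mem_univ, true_and, hgy] at h2
            rw [ht, div_mul_cancel₀ _ hkv.ne'] at h2
            linarith
        have h1 := hadd _ (ih _ hlt _ hy rfl) _ (hsmul t ht0.le v (subset_convexHull ℝ G hvG))
        simpa using h1
      · push Not at hne
        rw [hpt x hx.1 fun m => le_antisymm (hne m) (hx.2 m)]
        exact h0'
  exact fun x hx => main _ x hx rfl

/-- Add up one witness for each form in `τ`: nonnegative values cannot cancel. -/
theorem exists_sign_eq [Finite ι] {τ : ι → Prop}
    (h : ∀ m, τ m → ∃ v ∈ polyCone W g, 0 < g m v ∧ ∀ m', 0 < g m' v → τ m') :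
    ∃ x ∈ polyCone W g, ∀ m, 0 < g m x ↔ τ m := by
  classical
  have : Fintype ι := Fintype.ofFinite ι
  have h' : ∀ m, ∃ v ∈ polyCone W g, (τ m → 0 < g m v) ∧ ∀ m', 0 < g m' v → τ m' := by
    intro m
    by_cases hm : τ m
    · obtain ⟨v, hv, h1, h2⟩ := h m hm
      exact ⟨v, hv, fun _ => h1, h2⟩
    · exact ⟨0, ⟨W.zero_mem, fun m => by simp⟩, fun h => (hm h).elim, fun m' h => by simp at h⟩
  choose v hv h1 h2 using h'
  refine ⟨∑ m, v m, ⟨W.sum_mem fun m _ => (hv m).1, fun m => ?_⟩, fun m => ?_⟩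
  · rw [map_sum]; exact Finset.sum_nonneg fun k _ => (hv k).2 m
  · rw [map_sum]
    constructor
    · intro hpos
      obtain ⟨k, _, hk⟩ := Finset.exists_lt_of_sum_lt (s := Finset.univ) (f := fun _ => (0 : ℝ))
        (g := fun k => g m (v k)) (by simpa using hpos)
      exact h2 k m hk
    · intro hm
      exact Finset.sum_pos' (fun k _ => (hv k).2 m) ⟨m, Finset.mem_univ m, h1 m hm⟩

/-- A point of `F` with the largest support plays the part of a relative interior point and
determines `F`. -/
theorem exists_eq_sliceFace [TopologicalSpace V] [Finite ι] {F : Set V} (hne : F.Nonempty)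
    (hF : IsExposed ℝ (polyCone W g ∩ {x | s x = 1}) F) :
    ∃ x ∈ polyCone W g, s x = 1 ∧ F = sliceFace W s g (fun m => 0 < g m x) := by
  classical
  have : Fintype ι := Fintype.ofFinite ι
  obtain ⟨l, hl⟩ := hF hne
  have hFsub : ∀ x ∈ F, x ∈ polyCone W g ∧ s x = 1 := fun x hx => by
    rw [hl] at hx; exact hx.1
  have hFconv : Convex ℝ F := hF.convex (polyCone_convex.inter (by
    intro x hx y hy a b _ _ hab
    have hx' : s x = 1 := hx
    have hy' : s y = 1 := hy
    simpa [hx', hy'] using hab))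
  -- a point of `F` with maximal support
  obtain ⟨x, hxF, hmax⟩ : ∃ x ∈ F, ∀ y ∈ F, (Finset.univ.filter fun m => 0 < g m y).card ≤
      (Finset.univ.filter fun m => 0 < g m x).card := by
    let S : Set ℕ := (fun y => (Finset.univ.filter fun m => 0 < g m y).card) '' F
    have hS : S.Finite := (Set.finite_Iic (Fintype.card ι)).subset (by
      rintro _ ⟨y, _, rfl⟩; exact Finset.card_le_univ _)
    obtain ⟨k, ⟨x, hx, rfl⟩, hk⟩ := hS.exists_maximal (hne.image _)
    refine ⟨x, hx, fun y hy => ?_⟩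
    rcases le_total ((Finset.univ.filter fun m => 0 < g m y).card)
      ((Finset.univ.filter fun m => 0 < g m x).card) with h | h
    · exact h
    · exact hk ⟨y, hy, rfl⟩ h
  have hxc := hFsub x hxF
  refine ⟨x, hxc.1, hxc.2, Set.Subset.antisymm (fun y hy => ?_) fun y hy => ?_⟩
  · refine ⟨hFsub y hy, fun m hm => ?_⟩
    by_contra hym
    have hyc := hFsub y hy
    have hym' : 0 < g m y := lt_of_le_of_ne (hyc.1.2 m) (Ne.symm hym)
    -- The support of a midpoint is the union of the two supports, so `w` would beat the maximal
    -- `x`.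
    let w := (1 / 2 : ℝ) • x + (1 / 2 : ℝ) • y
    have hw : w ∈ F := hFconv hxF hy (by norm_num) (by norm_num) (by norm_num)
    have hgw : ∀ m, g m w = 1 / 2 * g m x + 1 / 2 * g m y := fun m => by simp [w]
    refine absurd (hmax w hw) (not_le.2 (Finset.card_lt_card ⟨fun k hk => ?_, fun hsub => ?_⟩))
    · simp only [Finset.mem_filter, Finset.mem_univ, true_and, hgw] at hk ⊢
      have := hyc.1.2 k
      linarith
    · have h1 : m ∈ Finset.univ.filter fun m => 0 < g m w := by
        simp only [Finset.mem_filter, Finset.mem_univ, true_and, hgw]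
        have := hxc.1.2 m
        linarith
      exact hm (by simpa using hsub h1)
  -- The segment from `y` can be prolonged a little beyond `x`. If `l y < l x`, then `l` would
  -- exceed its maximum there.
  · have hd : x - y ∈ faceSpace W g (fun m => 0 < g m x) := by
      refine ⟨W.sub_mem hxc.1.1 hy.1.1.1, fun m hm => ?_⟩
      rw [map_sub, hy.2 m hm, le_antisymm (not_lt.1 hm) (hxc.1.2 m), sub_zero]
    obtain ⟨t, ht, hmem⟩ := exists_step_mem_polyCone hxc.1 hd
    have hx' := hxF
    rw [hl] at hx' ⊢
    have h1 := hx'.2 (x + t • (x - y)) ⟨hmem, by simp [hxc.2, hy.1.2]⟩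
    have h2 : l (x + t • (x - y)) = l x + t * (l x - l y) := by simp
    rw [h2] at h1
    have h3 : l x ≤ l y := by
      by_contra hlt
      have := mul_pos ht (sub_pos.2 (not_le.1 hlt))
      linarith
    exact ⟨⟨hy.1.1, hy.1.2⟩, fun z hz => (hx'.2 z hz).trans h3⟩

section Exposed

variable [TopologicalSpace V] [IsTopologicalAddGroup V] [ContinuousSMul ℝ V] [T2Space V]
  [FiniteDimensional ℝ V]

/-- The exposing functional is minus the sum of the forms outside `τ`: it is at most zero on the
cone, with equality only where all of them vanish. -/
theorem isExposed_sliceFace [Finite ι] (τ : ι → Prop) :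
    IsExposed ℝ (polyCone W g ∩ {x | s x = 1}) (sliceFace W s g τ) := by
  classical
  have : Fintype ι := Fintype.ofFinite ι
  rintro ⟨z, hz⟩
  let l : V →ₗ[ℝ] ℝ := -∑ m ∈ Finset.univ.filter (fun m => ¬ τ m), g m
  have hl : ∀ x, l x = -∑ m ∈ Finset.univ.filter (fun m => ¬ τ m), g m x := fun x => by
    simp [l, LinearMap.sum_apply]
  have hl0 : ∀ x ∈ polyCone W g, l x ≤ 0 := fun x hx => by
    rw [hl]; exact neg_nonpos.2 (Finset.sum_nonneg fun m _ => hx.2 m)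
  have hz0 : ∀ x ∈ sliceFace W s g τ, l x = 0 := fun x hx => by
    rw [hl, Finset.sum_eq_zero, neg_zero]
    intro m hm
    exact hx.2 m (by simpa using hm)
  refine ⟨LinearMap.toContinuousLinearMap l, ?_⟩
  ext x
  constructor
  · intro hx
    refine ⟨⟨hx.1.1, hx.1.2⟩, fun y hy => ?_⟩
    change l y ≤ l x
    rw [hz0 x hx]; exact hl0 y hy.1
  · rintro ⟨hx, hmax⟩
    refine ⟨hx, fun m hm => ?_⟩
    have h1 : l z ≤ l x := hmax z ⟨hz.1.1, hz.1.2⟩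
    rw [hz0 z hz, hl] at h1
    have h2 := Finset.sum_nonneg (s := Finset.univ.filter (fun m => ¬ τ m))
      fun m _ => hx.1.2 m
    exact (Finset.sum_eq_zero_iff_of_nonneg fun m _ => hx.1.2 m).1
      (le_antisymm (by linarith) h2) m (by simpa using hm)

end Exposed

end Polyhedral

/-! ### Gaps, surpluses and explicit integer points -/

section Coordinates

variable {r : ℕ}

/-- The entry of index `n` of an `r`-tuple, extended by zero. -/
def entry (r n : ℕ) : (Fin r → ℝ) →ₗ[ℝ] ℝ :=
  if h : n < r then LinearMap.proj ⟨n, h⟩ else 0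

theorem entry_fin (i : Fin r) (u : Fin r → ℝ) : entry r i u = u i := by
  simp [entry]

theorem entry_of_le {n : ℕ} (h : r ≤ n) (u : Fin r → ℝ) : entry r n u = 0 := by
  simp [entry, not_lt.2 h]

/-- The difference of consecutive entries of `lam`. -/
def gapFst (r n : ℕ) : ((Fin r → ℝ) × (Fin r → ℝ)) →ₗ[ℝ] ℝ :=
  (entry r n - entry r (n + 1)) ∘ₗ LinearMap.fst ℝ _ _

/-- The difference of consecutive entries of `mu`. -/
def gapSnd (r n : ℕ) : ((Fin r → ℝ) × (Fin r → ℝ)) →ₗ[ℝ] ℝ :=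
  (entry r n - entry r (n + 1)) ∘ₗ LinearMap.snd ℝ _ _

/-- The amount by which the sum of the first `n` entries of `lam` exceeds that of `mu`. -/
def surplus (r n : ℕ) : ((Fin r → ℝ) × (Fin r → ℝ)) →ₗ[ℝ] ℝ :=
  ∑ j ∈ Finset.range n,
    (entry r j ∘ₗ LinearMap.fst ℝ _ _ - entry r j ∘ₗ LinearMap.snd ℝ _ _)

theorem gapFst_apply (n : ℕ) (x : (Fin r → ℝ) × (Fin r → ℝ)) :
    gapFst r n x = entry r n x.1 - entry r (n + 1) x.1 := rfl

theorem gapSnd_apply (n : ℕ) (x : (Fin r → ℝ) × (Fin r → ℝ)) :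
    gapSnd r n x = entry r n x.2 - entry r (n + 1) x.2 := rfl

theorem surplus_apply (n : ℕ) (x : (Fin r → ℝ) × (Fin r → ℝ)) :
    surplus r n x = ∑ j ∈ Finset.range n, (entry r j x.1 - entry r j x.2) := by
  simp [surplus, LinearMap.sum_apply]

theorem surplus_zero (x : (Fin r → ℝ) × (Fin r → ℝ)) : surplus r 0 x = 0 := by
  simp [surplus_apply]

theorem surplus_succ (n : ℕ) (x : (Fin r → ℝ) × (Fin r → ℝ)) :
    surplus r (n + 1) x = surplus r n x + (entry r n x.1 - entry r n x.2) := by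
  rw [surplus_apply, surplus_apply, Finset.sum_range_succ]

/-- The only relation used between the three families of forms: gaps of mu bend the surplus upwards,
gaps of lam bend it downwards, with the kink of gap `n` at index `n + 1`. -/
theorem gapSnd_sub_gapFst (n : ℕ) (x : (Fin r → ℝ) × (Fin r → ℝ)) :
    gapSnd r n x - gapFst r n x =
      surplus r n x - 2 * surplus r (n + 1) x + surplus r (n + 2) x := by
  simp only [gapFst_apply, gapSnd_apply, surplus_succ]
  ring

theorem surplus_of_le {n : ℕ} (h : r ≤ n) {x : (Fin r → ℝ) × (Fin r → ℝ)}
    (hx : surplus r r x = 0) : surplus r n x = 0 := by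
  induction n, h using Nat.le_induction with
  | base => exact hx
  | succ n hn ih => rw [surplus_succ, ih, entry_of_le hn, entry_of_le hn]; simp

theorem sum_Ico_telescope (φ : ℕ → ℝ) {j n : ℕ} (h : j ≤ n) :
    ∑ t ∈ Finset.Ico j n, (φ t - φ (t + 1)) = φ j - φ n := by
  induction n, h using Nat.le_induction with
  | base => simp
  | succ n hn ih => rw [Finset.sum_Ico_succ_top hn, ih]; ring

theorem entry_eq_sum_gap (u : Fin r → ℝ) {n : ℕ} (hn : n ≤ r) :
    entry r n u = ∑ t ∈ Finset.Ico n r, (entry r t u - entry r (t + 1) u) := by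
  rw [sum_Ico_telescope (fun t => entry r t u) hn, entry_of_le le_rfl, sub_zero]

/-- The linear forms defining the facets of the Kostka cone. -/
def kostkaForm (r : ℕ) (m : Fin r × Fin 3) : ((Fin r → ℝ) × (Fin r → ℝ)) →ₗ[ℝ] ℝ :=
  ![gapFst r m.1, gapSnd r m.1, surplus r (m.1 + 1)] m.2

/-- The span of the Kostka cone: both tuples have the same sum. -/
def kostkaSpan (r : ℕ) : Submodule ℝ ((Fin r → ℝ) × (Fin r → ℝ)) :=
  LinearMap.ker (surplus r r)

/-- The sum of all coordinates. -/
def kostkaTotal (r : ℕ) : ((Fin r → ℝ) × (Fin r → ℝ)) →ₗ[ℝ] ℝ :=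
  ∑ i, (LinearMap.proj i ∘ₗ LinearMap.fst ℝ _ _ + LinearMap.proj i ∘ₗ LinearMap.snd ℝ _ _)

theorem kostkaTotal_apply (x : (Fin r → ℝ) × (Fin r → ℝ)) :
    kostkaTotal r x = ∑ i, (x.1 i + x.2 i) := by
  simp [kostkaTotal, LinearMap.sum_apply]

theorem forall_kostka_index {p : Fin r × Fin 3 → Prop} :
    (∀ m, p m) ↔ ∀ i, p (i, 0) ∧ p (i, 1) ∧ p (i, 2) := by
  simp [Prod.forall, Fin.forall_fin_succ]

@[simp] theorem kostkaForm_zero (i : Fin r) : kostkaForm r (i, 0) = gapFst r i := rfl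
@[simp] theorem kostkaForm_one (i : Fin r) : kostkaForm r (i, 1) = gapSnd r i := rfl
@[simp] theorem kostkaForm_two (i : Fin r) : kostkaForm r (i, 2) = surplus r (i + 1) := rfl

theorem mem_kostkaSpan {x : (Fin r → ℝ) × (Fin r → ℝ)} :
    x ∈ kostkaSpan r ↔ surplus r r x = 0 := Iff.rfl

theorem mem_polyCone_kostka {x : (Fin r → ℝ) × (Fin r → ℝ)} :
    x ∈ polyCone (kostkaSpan r) (kostkaForm r) ↔ surplus r r x = 0 ∧
      ∀ n < r, 0 ≤ gapFst r n x ∧ 0 ≤ gapSnd r n x ∧ 0 ≤ surplus r (n + 1) x := by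
  unfold polyCone
  rw [Set.mem_ofPred_eq, forall_kostka_index, mem_kostkaSpan]
  simp [Fin.forall_iff]

theorem gapFst_nonneg {x : (Fin r → ℝ) × (Fin r → ℝ)}
    (hx : x ∈ polyCone (kostkaSpan r) (kostkaForm r)) (n : ℕ) : 0 ≤ gapFst r n x := by
  rcases lt_or_ge n r with h | h
  · exact ((mem_polyCone_kostka.1 hx).2 n h).1
  · rw [gapFst_apply, entry_of_le h, entry_of_le (by omega)]; simp

theorem gapSnd_nonneg {x : (Fin r → ℝ) × (Fin r → ℝ)}
    (hx : x ∈ polyCone (kostkaSpan r) (kostkaForm r)) (n : ℕ) : 0 ≤ gapSnd r n x := by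
  rcases lt_or_ge n r with h | h
  · exact ((mem_polyCone_kostka.1 hx).2 n h).2.1
  · rw [gapSnd_apply, entry_of_le h, entry_of_le (by omega)]; simp

theorem surplus_nonneg {x : (Fin r → ℝ) × (Fin r → ℝ)}
    (hx : x ∈ polyCone (kostkaSpan r) (kostkaForm r)) (n : ℕ) : 0 ≤ surplus r n x := by
  rcases n with _ | n
  · rw [surplus_zero]
  rcases lt_or_ge n r with h | h
  · exact ((mem_polyCone_kostka.1 hx).2 n h).2.2
  · rw [surplus_of_le (by omega) (mem_polyCone_kostka.1 hx).1]

theorem eq_zero_of_gap_eq_zero {x : (Fin r → ℝ) × (Fin r → ℝ)}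
    (h1 : ∀ n < r, gapFst r n x = 0) (h2 : ∀ n < r, gapSnd r n x = 0) : x = 0 := by
  ext i
  · rw [← entry_fin i x.1, entry_eq_sum_gap _ i.2.le]
    exact Finset.sum_eq_zero fun t ht => h1 t (Finset.mem_Ico.1 ht).2
  · rw [← entry_fin i x.2, entry_eq_sum_gap _ i.2.le]
    exact Finset.sum_eq_zero fun t ht => h2 t (Finset.mem_Ico.1 ht).2

theorem kostkaTotal_pos {x : (Fin r → ℝ) × (Fin r → ℝ)}
    (hx : x ∈ polyCone (kostkaSpan r) (kostkaForm r)) (h0 : x ≠ 0) : 0 < kostkaTotal r x := by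
  have h1 : ∀ i, 0 ≤ x.1 i := fun i => by
    rw [← entry_fin i x.1, entry_eq_sum_gap _ i.2.le]
    exact Finset.sum_nonneg fun t _ => gapFst_nonneg hx t
  have h2 : ∀ i, 0 ≤ x.2 i := fun i => by
    rw [← entry_fin i x.2, entry_eq_sum_gap _ i.2.le]
    exact Finset.sum_nonneg fun t _ => gapSnd_nonneg hx t
  rw [kostkaTotal_apply]
  refine lt_of_le_of_ne (Finset.sum_nonneg fun i _ => add_nonneg (h1 i) (h2 i)) fun h => h0 ?_
  have h3 := (Finset.sum_eq_zero_iff_of_nonneg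
    fun i _ => add_nonneg (h1 i) (h2 i)).1 h.symm
  ext i
  · have := h3 i (Finset.mem_univ i); exact le_antisymm (show x.1 i ≤ 0 by linarith [h2 i]) (h1 i)
  · have := h3 i (Finset.mem_univ i); exact le_antisymm (show x.2 i ≤ 0 by linarith [h1 i]) (h2 i)

/-- The pair of tuples with prescribed differences of consecutive entries. -/
def ofGaps (r : ℕ) (α β : ℕ → ℝ) : (Fin r → ℝ) × (Fin r → ℝ) :=
  (fun i => ∑ t ∈ Finset.Ico (i : ℕ) r, α t, fun i => ∑ t ∈ Finset.Ico (i : ℕ) r, β t)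

theorem entry_sum_Ico (α : ℕ → ℝ) (n : ℕ) :
    entry r n (fun i => ∑ t ∈ Finset.Ico (i : ℕ) r, α t) = ∑ t ∈ Finset.Ico n r, α t := by
  rcases lt_or_ge n r with h | h
  · exact entry_fin ⟨n, h⟩ _
  · rw [entry_of_le h, Finset.Ico_eq_empty (by omega), Finset.sum_empty]

theorem gapFst_ofGaps (α β : ℕ → ℝ) {n : ℕ} (h : n < r) : gapFst r n (ofGaps r α β) = α n := by
  rw [gapFst_apply, ofGaps, entry_sum_Ico, entry_sum_Ico, Finset.sum_eq_sum_Ico_succ_bot h]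
  ring

theorem gapSnd_ofGaps (α β : ℕ → ℝ) {n : ℕ} (h : n < r) : gapSnd r n (ofGaps r α β) = β n := by
  rw [gapSnd_apply, ofGaps, entry_sum_Ico, entry_sum_Ico, Finset.sum_eq_sum_Ico_succ_bot h]
  ring

/-- Second differences determine a sequence up to two constants. These are fixed by the zero at the
start and by flatness at `r`, where the entries of both tuples have run out. -/
theorem surplus_ofGaps {α β κ : ℕ → ℝ}
    (h : ∀ n < r, β n - α n = κ n - 2 * κ (n + 1) + κ (n + 2))
    (h0 : κ 0 = 0) (hr : κ (r + 1) = κ r) {n : ℕ} (hn : n ≤ r) :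
    surplus r n (ofGaps r α β) = κ n := by
  induction n with
  | zero => rw [surplus_zero, h0]
  | succ n ih =>
    rw [surplus_succ, ih (by omega), ofGaps, entry_sum_Ico, entry_sum_Ico,
      ← Finset.sum_sub_distrib]
    have : ∀ t ∈ Finset.Ico n r, α t - β t =
        (κ (t + 1) - κ t) - (κ (t + 1 + 1) - κ (t + 1)) := fun t ht => by
      linarith [h t (Finset.mem_Ico.1 ht).2]
    rw [Finset.sum_congr rfl this, sum_Ico_telescope (fun t => κ (t + 1) - κ t) (by omega), hr]
    ring

theorem sum_Iic_fin {u : Fin r → ℝ} (k : Fin r) :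
    ∑ i ∈ Finset.Iic k, u i = ∑ j ∈ Finset.range (k + 1), entry r j u := by
  refine Finset.sum_bij' (fun i _ => (i : ℕ))
    (fun j hj => ⟨j, by have := Finset.mem_range.1 hj; omega⟩) ?_ ?_ ?_ ?_ ?_
  · intro i hi
    have : (i : ℕ) ≤ k := Fin.le_def.1 (Finset.mem_Iic (α := Fin r).1 hi)
    simpa [Nat.lt_succ_iff] using this
  · intro j hj
    have := Finset.mem_range.1 hj
    exact Finset.mem_Iic.2 (show j ≤ (k : ℕ) by omega)
  · intro i _; rfl
  · intro j _; rfl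
  · intro i _; exact (entry_fin i u).symm

theorem sum_univ_fin {u : Fin r → ℝ} : ∑ i, u i = ∑ j ∈ Finset.range r, entry r j u := by
  rw [← Fin.sum_univ_eq_sum_range]
  exact Finset.sum_congr rfl fun i _ => (entry_fin i u).symm

theorem kostkaPoints_subset_polyCone :
    kostkaPoints r ⊆ polyCone (kostkaSpan r) (kostkaForm r) := by
  rintro _ ⟨n, lam, mu, ⟨hl, hln⟩, ⟨hm, hmn⟩, hdom, rfl⟩
  have hgap : ∀ u : Fin r → ℕ, Antitone u → ∀ k < r,
      0 ≤ entry r k (fun i => (u i : ℝ)) - entry r (k + 1) (fun i => (u i : ℝ)) := by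
    intro u hu k hk
    have h1 := entry_fin ⟨k, hk⟩ (fun i => (u i : ℝ))
    simp only at h1
    rw [h1]
    rcases lt_or_ge (k + 1) r with h | h
    · have h2 := entry_fin ⟨k + 1, h⟩ (fun i => (u i : ℝ))
      simp only at h2
      rw [h2, sub_nonneg, Nat.cast_le]
      exact hu (Fin.mk_le_mk.2 (Nat.le_succ k))
    · rw [entry_of_le h, sub_zero]; positivity
  refine mem_polyCone_kostka.2 ⟨?_, fun k hk => ⟨hgap lam hl k hk, hgap mu hm k hk, ?_⟩⟩
  · rw [surplus_apply, Finset.sum_sub_distrib, ← sum_univ_fin, ← sum_univ_fin, sub_eq_zero]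
    simp only
    exact_mod_cast hln.trans hmn.symm
  · have h1 := sum_Iic_fin (u := fun i => (lam i : ℝ)) ⟨k, hk⟩
    have h2 := sum_Iic_fin (u := fun i => (mu i : ℝ)) ⟨k, hk⟩
    simp only at h1 h2
    rw [surplus_apply, Finset.sum_sub_distrib, ← h1, ← h2, sub_nonneg]
    exact_mod_cast hdom ⟨k, hk⟩

theorem ofGaps_mem_kostkaPoints {α β : ℕ → ℕ} {κ : ℕ → ℝ}
    (h : ∀ n < r, (β n : ℝ) - α n = κ n - 2 * κ (n + 1) + κ (n + 2))
    (h0 : κ 0 = 0) (hr : κ r = 0) (hr' : κ (r + 1) = 0) (hpos : ∀ n ≤ r, 0 ≤ κ n) :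
    ofGaps r (fun n => α n) (fun n => β n) ∈ kostkaPoints r := by
  have hanti : ∀ γ : ℕ → ℕ, Antitone fun i : Fin r => ∑ t ∈ Finset.Ico (i : ℕ) r, γ t :=
    fun γ i j hij => Finset.sum_le_sum_of_subset (Finset.Ico_subset_Ico_left hij)
  have hs : ∀ n ≤ r, surplus r n (ofGaps r (fun n => α n) (fun n => β n)) = κ n :=
    fun n hn => surplus_ofGaps h h0 (hr'.trans hr.symm) hn
  refine ⟨_, fun i => ∑ t ∈ Finset.Ico (i : ℕ) r, α t, fun i => ∑ t ∈ Finset.Ico (i : ℕ) r, β t,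
    ⟨hanti α, rfl⟩, ⟨hanti β, ?_⟩, fun k => ?_, ?_⟩
  · have h1 := hs r le_rfl
    rw [hr, surplus_apply, Finset.sum_sub_distrib, ← sum_univ_fin, ← sum_univ_fin,
      sub_eq_zero] at h1
    simp only [ofGaps] at h1
    exact_mod_cast h1.symm
  · have h1 := hs (k + 1) k.2
    have h2 := hpos (k + 1) k.2
    rw [← h1, surplus_apply, Finset.sum_sub_distrib, ← sum_Iic_fin, ← sum_Iic_fin,
      sub_nonneg] at h2
    simp only [ofGaps] at h2
    exact_mod_cast h2
  · simp [ofGaps]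

theorem zero_mem_kostkaPoints : (0 : (Fin r → ℝ) × (Fin r → ℝ)) ∈ kostkaPoints r :=
  ⟨0, 0, 0, ⟨antitone_const, by simp⟩, ⟨antitone_const, by simp⟩, fun _ => le_rfl, by
    ext <;> simp⟩

theorem natCast_smul_mem_kostkaPoints (k : ℕ) {v : (Fin r → ℝ) × (Fin r → ℝ)}
    (hv : v ∈ kostkaPoints r) : (k : ℝ) • v ∈ kostkaPoints r := by
  obtain ⟨n, lam, mu, ⟨hl, hln⟩, ⟨hm, hmn⟩, hdom, rfl⟩ := hv
  refine ⟨k * n, fun i => k * lam i, fun i => k * mu i,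
    ⟨fun i j hij => Nat.mul_le_mul_left k (hl hij), ?_⟩,
    ⟨fun i j hij => Nat.mul_le_mul_left k (hm hij), ?_⟩, fun i => ?_, ?_⟩
  · rw [← Finset.mul_sum, hln]
  · rw [← Finset.mul_sum, hmn]
  · rw [← Finset.mul_sum, ← Finset.mul_sum]; exact Nat.mul_le_mul_left k (hdom i)
  · ext <;> simp

/-- Take lam = mu with a single unit gap; the surplus vanishes identically. -/
theorem exists_unit_mem_kostkaPoints {i : ℕ} : ∃ v ∈ kostkaPoints r, ∀ n < r,
    (0 < gapFst r n v ↔ n = i) ∧ (0 < gapSnd r n v ↔ n = i) ∧ ¬ 0 < surplus r (n + 1) v := by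
  have h : ∀ n < r, (((if n = i then 1 else 0 : ℕ) : ℝ)) - ((if n = i then 1 else 0 : ℕ) : ℝ) =
      (0 : ℝ) - 2 * 0 + 0 := fun n _ => by ring
  refine ⟨_, ofGaps_mem_kostkaPoints (κ := fun _ => 0) h rfl rfl rfl fun _ _ => le_rfl,
    fun n hn => ?_⟩
  rw [gapFst_ofGaps _ _ hn, gapSnd_ofGaps _ _ hn,
    surplus_ofGaps (κ := fun _ => 0) h rfl rfl (n := n + 1) hn]
  by_cases hni : n = i <;> simp [hni]

/-- Truncated subtraction is the hinge function max(n - p, 0), whose only kink is at `p`. Tents are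
combinations of hinges. -/
theorem hinge_second_difference (p n : ℕ) :
    ((n - p : ℕ) : ℝ) - 2 * ((n + 1 - p : ℕ) : ℝ) + ((n + 2 - p : ℕ) : ℝ) =
      if n + 1 = p then 1 else 0 := by
  split_ifs with h
  · subst h; simp
  · rcases lt_or_ge n p with h1 | h1
    · rw [show n - p = 0 by omega, show n + 1 - p = 0 by omega, show n + 2 - p = 0 by omega]
      simp
    · rw [Nat.cast_sub h1, Nat.cast_sub (by omega), Nat.cast_sub (by omega)]
      push_cast; ring

/-- The integer points whose surplus is a tent with feet `p`, `q` and peak `j`. -/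
theorem exists_tent_mem_kostkaPoints {p j q : ℕ} (hpj : p < j) (hjq : j < q) (hqr : q ≤ r) :
    ∃ v ∈ kostkaPoints r, ∀ n < r,
      (0 < gapFst r n v ↔ n + 1 = j) ∧ (0 < gapSnd r n v ↔ n + 1 = p ∨ n + 1 = q) ∧
      (0 < surplus r (n + 1) v ↔ p < n + 1 ∧ n + 1 < q) := by
  obtain ⟨t, ht, rfl⟩ : ∃ t, 0 < t ∧ j = p + t := ⟨j - p, by omega, by omega⟩
  obtain ⟨s, hs, rfl⟩ : ∃ s, 0 < s ∧ q = p + t + s := ⟨q - (p + t), by omega, by omega⟩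
  have ht' : (0 : ℝ) < t := by exact_mod_cast ht
  have hs' : (0 : ℝ) < s := by exact_mod_cast hs
  -- Slope `s` for `t` steps, then slope `-t` for `s` steps, then zero. The kinks `s`, `-(s + t)`,
  -- `t` are integers, so they can serve as gaps of integer tuples.
  set κ : ℕ → ℝ := fun n => s * ((n - p : ℕ) : ℝ) - (s + t) * ((n - (p + t) : ℕ) : ℝ) +
    t * ((n - (p + t + s) : ℕ) : ℝ) with hκ
  let α : ℕ → ℕ := fun n => if n + 1 = p + t then s + t else 0
  let β : ℕ → ℕ := fun n => (if n + 1 = p then s else 0) + if n + 1 = p + t + s then t else 0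
  have h : ∀ n < r, (β n : ℝ) - α n = κ n - 2 * κ (n + 1) + κ (n + 2) := fun n _ => by
    have h1 := hinge_second_difference p n
    have h2 := hinge_second_difference (p + t) n
    have h3 := hinge_second_difference (p + t + s) n
    have : κ n - 2 * κ (n + 1) + κ (n + 2) = s * (if n + 1 = p then 1 else 0) -
        (s + t) * (if n + 1 = p + t then 1 else 0) +
        t * (if n + 1 = p + t + s then 1 else 0) := by
      rw [← h1, ← h2, ← h3, hκ]; ring
    rw [this]
    simp only [α, β]
    push_cast
    simp only [mul_ite, mul_one, mul_zero]
    ring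
  have hleft : ∀ n, n ≤ p → κ n = 0 := fun n hn => by
    simp [hκ, show n - p = 0 by omega, show n - (p + t) = 0 by omega,
      show n - (p + t + s) = 0 by omega]
  have hright : ∀ n, p + t + s ≤ n → κ n = 0 := fun n hn => by
    simp only [hκ]
    rw [Nat.cast_sub (by omega), Nat.cast_sub (by omega), Nat.cast_sub hn]
    push_cast; ring
  have hmid : ∀ n, p < n → n < p + t + s → 0 < κ n := fun n h1 h2 => by
    simp only [hκ]
    rw [show n - (p + t + s) = 0 by omega]
    rcases le_total n (p + t) with h3 | h3
    · rw [show n - (p + t) = 0 by omega]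
      have : (0 : ℝ) < ((n - p : ℕ) : ℝ) := by exact_mod_cast (by omega : 0 < n - p)
      simp only [Nat.cast_zero, mul_zero, sub_zero, add_zero]
      positivity
    · have h2' : (n : ℝ) < p + t + s := by exact_mod_cast h2
      rw [Nat.cast_sub h1.le, Nat.cast_sub h3]
      push_cast
      have := mul_pos ht' (sub_pos.2 h2')
      nlinarith
  have h0 : κ 0 = 0 := hleft 0 (Nat.zero_le _)
  have hr : κ r = 0 := hright r hqr
  have hr' : κ (r + 1) = 0 := hright _ (by omega)
  have hpos : ∀ n ≤ r, 0 ≤ κ n := fun n _ => by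
    rcases le_or_gt n p with h1 | h1
    · exact (hleft n h1).ge
    rcases le_or_gt (p + t + s) n with h2 | h2
    · exact (hright n h2).ge
    · exact (hmid n h1 h2).le
  refine ⟨_, ofGaps_mem_kostkaPoints h h0 hr hr' hpos, fun n hn => ?_⟩
  rw [gapFst_ofGaps _ _ hn, gapSnd_ofGaps _ _ hn,
    surplus_ofGaps h h0 (hr'.trans hr.symm) (n := n + 1) hn]
  refine ⟨?_, ?_, ?_⟩
  · simp only [α, Nat.cast_pos]
    split_ifs with h1 <;> (simp [h1]; try omega)
  · simp only [β, Nat.cast_pos]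
    split_ifs with h1 h2 h2 <;> (simp [h1, h2]; try omega)
  · constructor
    · intro hp
      by_contra hn'
      rcases le_or_gt (n + 1) p with h1 | h1
      · exact hp.ne' (hleft _ h1)
      · exact hp.ne' (hright _ (by omega))
    · rintro ⟨h1, h2⟩
      exact hmid _ h1 h2

end Coordinates

/-! ### The automaton of realizable sign patterns -/

section SignPatterns

/-- The signs of `lam_n - lam_{n+1}`, of `mu_n - mu_{n+1}` and of the surplus after the entry of
index `n`: `true` stands for positive, `false` for zero. -/
abbrev SignLetter : Type := Bool × Bool × Bool

/-- The automaton that recognizes sign patterns. Its state describes the surplus between two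
consecutive positions: `none` if it vanishes, and otherwise whether the current run of positive
surpluses already contains an index with a positive gap of `lam`. -/
def signStep (e : Option Bool) (l : SignLetter) (e' : Option Bool) : Bool :=
  if l.2.2 then e.isSome && (e' == some (e.getD false || l.1))
  else e != some false && e' != some true &&
    if l.2.1 then l.1 || e.isSome || e'.isSome else !l.1 && e.isNone && e'.isNone

/-- The state sequence `s` is an accepting run of the automaton on the first `r` letters
of `w`. -/
def IsSignRun (r : ℕ) (w : ℕ → SignLetter) (s : ℕ → Option Bool) : Prop :=
  s 0 ≠ some true ∧ s r = none ∧ ∀ n < r, signStep (s n) (w n) (s (n + 1))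

theorem signStep_state_left : ∀ e l e', signStep e l e' → l.2.2 = true → e ≠ none := by decide

theorem signStep_state_right : ∀ e l e', signStep e l e' → l.2.2 = true → e' ≠ none := by decide

theorem signStep_fresh : ∀ e l e', signStep e l e' → l.2.2 = true → e = some false →
    l.1 = false → e' = some false := by decide

theorem signStep_valley_left : ∀ e l e', signStep e l e' → l.2.2 = false → e ≠ some false := by
  decide

theorem signStep_valley_right : ∀ e l e', signStep e l e' → l.2.2 = false → e' ≠ none →
    e' = some false := by decide

theorem signStep_snd_of_left : ∀ e l e', signStep e l e' → l.2.2 = false → e ≠ none →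
    l.2.1 = true := by decide

theorem signStep_snd_of_right : ∀ e l e', signStep e l e' → l.2.2 = false → e' ≠ none →
    l.2.1 = true := by decide

theorem signStep_snd : ∀ e l e', signStep e l e' → l.2.2 = false → l.2.1 = true →
    l.1 = true ∨ e ≠ none ∨ e' ≠ none := by decide

theorem signStep_fst : ∀ e l e', signStep e l e' → l.2.2 = false → l.1 = true →
    l.2.1 = true := by decide

variable {r : ℕ} {w : ℕ → SignLetter} {s : ℕ → Option Bool}

/-- The final state is `none`, so every run ends; it cannot end in the state `some false`, so a
positive gap of lam must be read first. -/
theorem IsSignRun.exists_right (h : IsSignRun r w s) {n : ℕ} (hn : n ≤ r) (hs : s n ≠ none) :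
    ∃ t, n ≤ t ∧ t < r ∧ (∀ k, n ≤ k → k < t → (w k).2.2 = true) ∧ (w t).2.2 = false ∧
      (w t).2.1 = true ∧ (s n = some false → ∃ j, n ≤ j ∧ j < t ∧ (w j).1 = true) := by
  induction hn using Nat.decreasingInduction with
  | self => exact (hs h.2.1).elim
  | of_succ n hn ih =>
    have hstep := h.2.2 n hn
    cases hc : (w n).2.2 with
    | false =>
      exact ⟨n, le_rfl, hn, fun k h1 h2 => by omega, hc,
        signStep_snd_of_left _ _ _ hstep hc hs,
        fun h0 => (signStep_valley_left _ _ _ hstep hc h0).elim⟩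
    | true =>
      obtain ⟨t, h1, h2, h3, h4, h5, h6⟩ := ih (signStep_state_right _ _ _ hstep hc)
      refine ⟨t, by omega, h2, fun k hk hkt => ?_, h4, h5, fun h0 => ?_⟩
      · rcases hk.eq_or_lt with rfl | hk
        · exact hc
        · exact h3 k hk hkt
      · cases ha : (w n).1 with
        | true => exact ⟨n, le_rfl, by omega, ha⟩
        | false =>
          obtain ⟨j, hj, hjt, hja⟩ := h6 (signStep_fresh _ _ _ hstep hc h0 ha)
          exact ⟨j, by omega, hjt, hja⟩

/-- Going left, a run stops after a zero surplus or at index zero. Either way its first state is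
`some false`, at index zero because `some true` is excluded there. -/
theorem IsSignRun.exists_left (h : IsSignRun r w s) {n : ℕ} (hn : n ≤ r) (hs : s n ≠ none) :
    ∃ p, p ≤ n ∧ (∀ k, p ≤ k → k < n → (w k).2.2 = true) ∧
      (∀ k, p = k + 1 → (w k).2.2 = false ∧ (w k).2.1 = true) ∧ s p = some false := by
  induction n with
  | zero =>
    refine ⟨0, le_rfl, fun k _ hk => by omega, fun k hk => by omega, ?_⟩
    have h0 := h.1
    match hs0 : s 0 with
    | none => exact (hs hs0).elim
    | some true => exact (h0 hs0).elim
    | some false => rfl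
  | succ n ih =>
    have hstep := h.2.2 n hn
    cases hc : (w n).2.2 with
    | false =>
      refine ⟨n + 1, le_rfl, fun k h1 h2 => by omega, fun k hk => ?_,
        signStep_valley_right _ _ _ hstep hc hs⟩
      obtain rfl : n = k := by omega
      exact ⟨hc, signStep_snd_of_right _ _ _ hstep hc hs⟩
    | true =>
      obtain ⟨p, h1, h2, h3, h4⟩ := ih (by omega) (signStep_state_left _ _ _ hstep hc)
      refine ⟨p, by omega, fun k hk hkn => ?_, h3, h4⟩
      rcases (Nat.lt_succ_iff.1 hkn).eq_or_lt with rfl | hk'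
      · exact hc
      · exact h2 k hk hk'

/-- Around a nonzero state there is a maximal run of positive surpluses, which contains a
positive gap of `lam`. -/
theorem IsSignRun.exists_run (h : IsSignRun r w s) {n : ℕ} (hn : n ≤ r) (hs : s n ≠ none) :
    ∃ p j t, p ≤ j ∧ j < t ∧ t < r ∧ p ≤ n ∧ n ≤ t ∧ (w j).1 = true ∧
      (∀ k, p ≤ k → k < t → (w k).2.2 = true) ∧
      (∀ k, p = k + 1 → (w k).2.2 = false ∧ (w k).2.1 = true) ∧ (w t).2.2 = false ∧
      (w t).2.1 = true := by
  obtain ⟨p, hp1, hp2, hp3, hp4⟩ := h.exists_left hn hs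
  obtain ⟨t, ht1, ht2, ht3, ht4, ht5, ht6⟩ :=
    h.exists_right (hp1.trans hn) (by rw [hp4]; simp)
  obtain ⟨j, hj1, hj2, hj3⟩ := ht6 hp4
  refine ⟨p, j, t, hj1, hj2, ht2, hp1, ?_, hj3, ht3, hp3, ht4, ht5⟩
  by_contra hlt
  have := hp2 t ht1 (by omega)
  rw [ht4] at this
  simp at this

/-- The signs of `v` are dominated by the pattern `w`. -/
def SignsBelow (r : ℕ) (w : ℕ → SignLetter) (v : (Fin r → ℝ) × (Fin r → ℝ)) : Prop :=
  ∀ n < r, (0 < gapFst r n v → (w n).1 = true) ∧ (0 < gapSnd r n v → (w n).2.1 = true) ∧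
    (0 < surplus r (n + 1) v → (w n).2.2 = true)

theorem exists_unit_signsBelow {n : ℕ} (hn : n < r) (ha : (w n).1 = true)
    (hb : (w n).2.1 = true) :
    ∃ v ∈ kostkaPoints r, SignsBelow r w v ∧ 0 < gapFst r n v ∧ 0 < gapSnd r n v := by
  obtain ⟨v, hv, h⟩ := exists_unit_mem_kostkaPoints (r := r) (i := n)
  refine ⟨v, hv, fun k hk => ⟨fun h1 => ?_, fun h1 => ?_, fun h1 => ((h k hk).2.2 h1).elim⟩,
    (h n hn).1.2 rfl, (h n hn).2.1.2 rfl⟩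
  · rw [(h k hk).1.1 h1, ha]
  · rw [(h k hk).2.1.1 h1, hb]

theorem exists_tent_signsBelow {p j t : ℕ} (hpj : p ≤ j) (hjt : j < t) (htr : t < r)
    (ha : (w j).1 = true) (hc : ∀ k, p ≤ k → k < t → (w k).2.2 = true)
    (hp : ∀ k, p = k + 1 → (w k).2.1 = true) (ht : (w t).2.1 = true) :
    ∃ v ∈ kostkaPoints r, SignsBelow r w v ∧ 0 < gapFst r j v ∧ 0 < gapSnd r t v ∧
      (∀ k, p = k + 1 → 0 < gapSnd r k v) ∧
      ∀ k, p ≤ k → k < t → 0 < surplus r (k + 1) v := by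
  -- Letter `n` carries the surplus of index `n + 1`, so the peak and the right foot move up by one;
  -- the left foot `p` belongs to letter `p - 1`, if there is one.
  obtain ⟨v, hv, h⟩ := exists_tent_mem_kostkaPoints (r := r) (p := p) (j := j + 1) (q := t + 1)
    (by omega) (by omega) (by omega)
  refine ⟨v, hv, fun k hk => ⟨fun h1 => ?_, fun h1 => ?_, fun h1 => ?_⟩,
    (h j (by omega)).1.2 rfl, (h t htr).2.1.2 (Or.inr rfl),
    fun k hk => (h k (by omega)).2.1.2 (Or.inl hk.symm),
    fun k h1 h2 => (h k (by omega)).2.2.2 ⟨by omega, by omega⟩⟩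
  · have := (h k hk).1.1 h1
    obtain rfl : k = j := by omega
    exact ha
  · rcases (h k hk).2.1.1 h1 with h2 | h2
    · exact hp k h2.symm
    · obtain rfl : k = t := by omega
      exact ht
  · have := (h k hk).2.2.1 h1
    exact hc k (by omega) (by omega)

theorem IsSignRun.exists_surplus_pos (h : IsSignRun r w s) {n : ℕ} (hn : n < r)
    (hw : (w n).2.2 = true) :
    ∃ v ∈ kostkaPoints r, SignsBelow r w v ∧ 0 < surplus r (n + 1) v := by
  obtain ⟨p, j, t, h1, h2, h3, h4, h5, h6, h7, h8, h9, h10⟩ :=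
    h.exists_run hn.le (signStep_state_left _ _ _ (h.2.2 n hn) hw)
  obtain ⟨v, hv, hsv, _, _, _, hpos⟩ :=
    exists_tent_signsBelow h1 h2 h3 h6 h7 (fun k hk => (h8 k hk).2) h10
  refine ⟨v, hv, hsv, hpos n h4 (lt_of_le_of_ne h5 fun hnt => ?_)⟩
  rw [hnt, h9] at hw
  simp at hw

theorem IsSignRun.exists_gapFst_pos (h : IsSignRun r w s) {n : ℕ} (hn : n < r)
    (hw : (w n).1 = true) :
    ∃ v ∈ kostkaPoints r, SignsBelow r w v ∧ 0 < gapFst r n v := by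
  cases hc : (w n).2.2 with
  | false =>
    obtain ⟨v, hv, hsv, hpos, _⟩ := exists_unit_signsBelow hn hw
      (signStep_fst _ _ _ (h.2.2 n hn) hc hw)
    exact ⟨v, hv, hsv, hpos⟩
  | true =>
    obtain ⟨p, j, t, h1, h2, h3, h4, h5, h6, h7, h8, h9, h10⟩ :=
      h.exists_run hn.le (signStep_state_left _ _ _ (h.2.2 n hn) hc)
    have hnt : n < t := lt_of_le_of_ne h5 fun hnt => by
      rw [hnt, h9] at hc
      simp at hc
    obtain ⟨v, hv, hsv, hpos, _⟩ :=
      exists_tent_signsBelow h4 hnt h3 hw h7 (fun k hk => (h8 k hk).2) h10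
    exact ⟨v, hv, hsv, hpos⟩

/-- If lam has no gap at `n`, then `n` is made a foot of a tent: the right foot if the peak lies
before `n`, the left foot if it lies after. This works inside a run and at either of its ends. -/
theorem IsSignRun.exists_gapSnd_pos (h : IsSignRun r w s) {n : ℕ} (hn : n < r)
    (hw : (w n).2.1 = true) :
    ∃ v ∈ kostkaPoints r, SignsBelow r w v ∧ 0 < gapSnd r n v := by
  have hstep := h.2.2 n hn
  cases ha : (w n).1 with
  | true =>
    obtain ⟨v, hv, hsv, _, hpos⟩ := exists_unit_signsBelow hn ha hw
    exact ⟨v, hv, hsv, hpos⟩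
  | false =>
    cases hc : (w n).2.2 with
    | true =>
      obtain ⟨p, j, t, h1, h2, h3, h4, h5, h6, h7, h8, h9, h10⟩ :=
        h.exists_run hn.le (signStep_state_left _ _ _ hstep hc)
      rcases lt_trichotomy j n with hjn | rfl | hjn
      · obtain ⟨v, hv, hsv, _, hpos, _⟩ := exists_tent_signsBelow h1 hjn hn h6
          (fun k hk hkn => h7 k hk (by omega)) (fun k hk => (h8 k hk).2) hw
        exact ⟨v, hv, hsv, hpos⟩
      · rw [ha] at h6; simp at h6
      · obtain ⟨v, hv, hsv, _, _, hpos, _⟩ := exists_tent_signsBelow (p := n + 1) hjn h2 h3 h6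
          (fun k hk hkn => h7 k (by omega) hkn)
          (fun k hk => by obtain rfl : n = k := by omega
                          exact hw) h10
        exact ⟨v, hv, hsv, hpos n rfl⟩
    | false =>
      rcases signStep_snd _ _ _ hstep hc hw with h0 | h0 | h0
      · rw [ha] at h0; simp at h0
      · obtain ⟨p, j, t, h1, h2, h3, h4, h5, h6, h7, h8, h9, h10⟩ := h.exists_run hn.le h0
        obtain rfl : n = t := by
          by_contra hnt
          have := h7 n h4 (by omega)
          rw [hc] at this; simp at this
        obtain ⟨v, hv, hsv, _, hpos, _⟩ := exists_tent_signsBelow h1 h2 h3 h6 h7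
          (fun k hk => (h8 k hk).2) h10
        exact ⟨v, hv, hsv, hpos⟩
      · obtain ⟨p, j, t, h1, h2, h3, h4, h5, h6, h7, h8, h9, h10⟩ := h.exists_run hn h0
        obtain rfl : p = n + 1 := by
          by_contra hnt
          have := h7 n (by omega) (by omega)
          rw [hc] at this; simp at this
        obtain ⟨v, hv, hsv, _, _, hpos, _⟩ := exists_tent_signsBelow h1 h2 h3 h6 h7
          (fun k hk => (h8 k hk).2) h10
        exact ⟨v, hv, hsv, hpos n rfl⟩

/-- Whether the run of positive surpluses that ends just before index `n` contains a positive
gap of `lam`. -/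
def hasPeak (w : ℕ → SignLetter) : ℕ → Bool
  | 0 => false
  | n + 1 => (w n).2.2 && ((w n).1 || hasPeak w n)

open Classical in
/-- The sign pattern of a point. -/
noncomputable def signWord (x : (Fin r → ℝ) × (Fin r → ℝ)) (n : ℕ) : SignLetter :=
  (decide (0 < gapFst r n x), decide (0 < gapSnd r n x), decide (0 < surplus r (n + 1) x))

/-- Before its first positive gap of `lam`, a run of surpluses is increasing by convexity. -/
theorem surplus_lt_of_hasPeak_eq_false {x : (Fin r → ℝ) × (Fin r → ℝ)}
    (hx : x ∈ polyCone (kostkaSpan r) (kostkaForm r)) (n : ℕ)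
    (hp : hasPeak (signWord x) n = false) (hpos : 0 < surplus r n x ∨ 0 < surplus r (n + 1) x) :
    surplus r n x < surplus r (n + 1) x := by
  induction n with
  | zero =>
    rw [surplus_zero] at hpos ⊢
    exact hpos.resolve_left (lt_irrefl _)
  | succ n ih =>
    rcases (surplus_nonneg hx (n + 1)).lt_or_eq with hc | hc
    · simp only [hasPeak, signWord, hc, decide_true, Bool.true_and, Bool.or_eq_false_iff,
        decide_eq_false_iff_not, not_lt] at hp
      have h1 := ih hp.2 (Or.inr hc)
      have h2 := gapSnd_sub_gapFst n x
      have h3 := gapSnd_nonneg hx n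
      have h4 : surplus r (n + 1 + 1) x = surplus r (n + 2) x := rfl
      linarith [hp.1]
    · rw [← hc] at hpos ⊢
      exact hpos.resolve_left (lt_irrefl _)

/-- A run that has met no gap of lam is strictly increasing, so it cannot return to zero. At a zero
surplus, the gap of mu equals that of lam plus the two neighbouring surpluses. -/
theorem exists_isSignRun_signWord {x : (Fin r → ℝ) × (Fin r → ℝ)}
    (hx : x ∈ polyCone (kostkaSpan r) (kostkaForm r)) : ∃ s, IsSignRun r (signWord x) s := by
  classical
  refine ⟨fun n => if 0 < surplus r n x ∨ 0 < surplus r (n + 1) x then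
    some (hasPeak (signWord x) n) else none, ?_, ?_, fun n hn => ?_⟩
  · simp only [hasPeak]
    split_ifs <;> simp
  · have h := (mem_polyCone_kostka.1 hx).1
    simp [h, surplus_of_le (Nat.le_succ r) h]
  · have hinv := surplus_lt_of_hasPeak_eq_false hx n
    have hd := gapSnd_sub_gapFst n x
    have hA := gapFst_nonneg hx n
    have hB := gapSnd_nonneg hx n
    have h0 := surplus_nonneg hx n
    have h2 := surplus_nonneg hx (n + 2)
    rcases (surplus_nonneg hx (n + 1)).lt_or_eq with hc | hc
    · simp [signStep, hasPeak, signWord, hc, Bool.or_comm]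
    · have hl : (signWord x n).2.2 = false := by simp [signWord, ← hc]
      have hpk : 0 < surplus r n x → hasPeak (signWord x) n = true := fun hp => by
        by_contra hne
        have := hinv (by simpa using hne) (Or.inl hp)
        linarith
      rw [← hc] at hd
      have hs : (if 0 < surplus r n x ∨ 0 < surplus r (n + 1) x then
          some (hasPeak (signWord x) n) else none) =
          if 0 < surplus r n x then some true else none := by
        rw [← hc]
        simp only [lt_irrefl, or_false]
        split_ifs with h
        · rw [hpk h]
        · rfl
      have hs' : (if 0 < surplus r (n + 1) x ∨ 0 < surplus r (n + 1 + 1) x then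
          some (hasPeak (signWord x) (n + 1)) else none) =
          if 0 < surplus r (n + 2) x then some false else none := by
        rw [← hc]
        simp only [lt_irrefl, false_or, hasPeak, hl, Bool.false_and]
      simp only [hs, hs', signStep, hl]
      rcases hB.lt_or_eq with hb | hb
      · have : 0 < gapFst r n x ∨ 0 < surplus r n x ∨ 0 < surplus r (n + 2) x := by
          by_contra hne
          push Not at hne
          linarith
        rcases this with h | h | h
        · split_ifs <;> simp_all [signWord]
        · split_ifs <;> simp_all [signWord]
        · split_ifs <;> simp_all [signWord]
      · have e1 : gapFst r n x = 0 := by linarith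
        have e2 : surplus r n x = 0 := by linarith
        have e3 : surplus r (n + 2) x = 0 := by linarith
        simp [e2, e3, signWord, e1, ← hb]

end SignPatterns

/-! ### Dimension of a face through a discrete Dirichlet problem -/

section FaceDimension

variable {r : ℕ}

/-- Maximum principle: a function that vanishes at the origin and far out, and is affine around
each of its nonzero values, vanishes. -/
theorem nonpos_of_affine_of_ne_zero {u : ℕ → ℝ} {R : ℕ} (h0 : u 0 = 0)
    (hR : ∀ n, R ≤ n → u n = 0) (h : ∀ n, u (n + 1) ≠ 0 → u n - 2 * u (n + 1) + u (n + 2) = 0)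
    (n : ℕ) : u n ≤ 0 := by
  classical
  by_contra hn
  have hex : ∃ n, 0 < u n := ⟨n, not_le.1 hn⟩
  obtain ⟨k, hk⟩ : ∃ k, Nat.find hex = k + 1 :=
    Nat.exists_eq_succ_of_ne_zero fun h1 => by
      have := Nat.find_spec hex
      rw [h1, h0] at this
      exact lt_irrefl _ this
  have hpos : 0 < u (k + 1) := hk ▸ Nat.find_spec hex
  have hneg : u k ≤ 0 := not_lt.1 (Nat.find_min hex (by omega))
  -- After the first positive value the function keeps its positive slope, and so it is still
  -- positive beyond `R`.
  have key : ∀ m, 0 < u (k + 1 + m) ∧ u (k + m) < u (k + 1 + m) := by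
    intro m
    induction m with
    | zero => exact ⟨hpos, by simpa using hneg.trans_lt hpos⟩
    | succ m ih =>
      have e1 : k + 1 + m = k + m + 1 := by ring
      have e2 : k + 1 + (m + 1) = k + m + 2 := by ring
      have e3 : k + (m + 1) = k + m + 1 := by ring
      rw [e1] at ih
      have := h (k + m) ih.1.ne'
      rw [e2, e3]
      constructor <;> linarith
  have := (key R).1
  rw [hR _ (by omega)] at this
  exact lt_irrefl _ this

theorem eq_zero_of_affine_of_ne_zero {u : ℕ → ℝ} {R : ℕ} (h0 : u 0 = 0)
    (hR : ∀ n, R ≤ n → u n = 0) (h : ∀ n, u (n + 1) ≠ 0 → u n - 2 * u (n + 1) + u (n + 2) = 0)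
    (n : ℕ) : u n = 0 := by
  refine le_antisymm (nonpos_of_affine_of_ne_zero h0 hR h n) ?_
  have := nonpos_of_affine_of_ne_zero (u := fun n => -u n) (R := R) (by simp [h0])
    (fun n hn => by simp [hR n hn])
    (fun n hn => by have := h n (by simpa using hn); linarith) n
  simpa using this

/-- The entries of a tuple, moved up by one place. -/
def shiftedEntry (r : ℕ) : ℕ → (Fin r → ℝ) →ₗ[ℝ] ℝ
  | 0 => 0
  | n + 1 => entry r n

/-- The discrete Dirichlet problem with prescribed second differences on `c` and zeros off `c`
is solvable. -/
theorem exists_dirichlet_solution (r : ℕ) (c : ℕ → Prop) (hc : ∀ n, c n → n < r) (h : ℕ → ℝ) :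
    ∃ κ : ℕ → ℝ, κ 0 = 0 ∧ (∀ n, ¬ c n → κ (n + 1) = 0) ∧
      ∀ n, c n → κ n - 2 * κ (n + 1) + κ (n + 2) = h n := by
  classical
  let T : (Fin r → ℝ) →ₗ[ℝ] (Fin r → ℝ) := LinearMap.pi fun i =>
    if c i then shiftedEntry r i - (2 : ℝ) • shiftedEntry r (i + 1) + shiftedEntry r (i + 2)
    else shiftedEntry r (i + 1)
  have hT : ∀ u i, T u i = if c i then shiftedEntry r i u - 2 * shiftedEntry r (i + 1) u +
      shiftedEntry r (i + 2) u else shiftedEntry r (i + 1) u := fun u i => by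
    simp only [T, LinearMap.pi_apply]
    split_ifs <;> simp
  have hbig : ∀ u n, r + 1 ≤ n → shiftedEntry r n u = 0 := by
    rintro u (_ | n) hn
    · rfl
    · exact entry_of_le (by omega) u
  have hinj : Function.Injective T := by
    rw [← LinearMap.ker_eq_bot, LinearMap.ker_eq_bot']
    intro u hu
    have h1 : ∀ n, shiftedEntry r n u = 0 :=
      eq_zero_of_affine_of_ne_zero (R := r + 1) rfl (hbig u) fun n hn => by
        have hnr : n < r := by
          by_contra hnr
          exact hn (hbig u _ (by omega))
        have h2 := hT u ⟨n, hnr⟩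
        rw [hu] at h2
        simp only [Pi.zero_apply] at h2
        split_ifs at h2 with h3
        · exact h2.symm
        · exact (hn h2.symm).elim
    ext i
    rw [← entry_fin i u]
    exact h1 (i + 1)
  -- `T` is an endomorphism of a finite-dimensional space, so uniqueness yields existence.
  obtain ⟨u, hu⟩ := LinearMap.injective_iff_surjective.1 hinj
    fun i => if c i then h i else 0
  refine ⟨fun n => shiftedEntry r n u, rfl, fun n hn => ?_, fun n hn => ?_⟩
  · rcases lt_or_ge n r with hnr | hnr
    · have := hT u ⟨n, hnr⟩
      rw [hu] at this
      simpa [hn] using this.symm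
    · exact hbig u _ (by omega)
  · have := hT u ⟨n, hc n hn⟩
    rw [hu] at this
    simpa [hn] using this.symm

/-- The positions at which a pattern is positive, as a predicate on the facets. -/
def wordSupport (f : Fin r → SignLetter) (m : Fin r × Fin 3) : Prop :=
  ![(f m.1).1, (f m.1).2.1, (f m.1).2.2] m.2 = true

/-- A finite word continued by zeros. -/
def extendWord (f : Fin r → SignLetter) (n : ℕ) : SignLetter :=
  if h : n < r then f ⟨n, h⟩ else (false, false, false)

/-- The word `f` is accepted by the automaton. -/
def SignAccepted (f : Fin r → SignLetter) : Prop := ∃ s, IsSignRun r (extendWord f) s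

/-- The contribution of a letter to the dimension of a face. -/
def signWeight (l : SignLetter) : ℕ :=
  (if l.1 then 1 else 0) + if l.2.1 && l.2.2 then 1 else 0

theorem extendWord_of_lt (f : Fin r → SignLetter) {n : ℕ} (h : n < r) :
    extendWord f n = f ⟨n, h⟩ := dif_pos h

theorem wordSupport_injective : Function.Injective (wordSupport (r := r)) := by
  intro f f' h
  funext i
  have h' : ∀ k, wordSupport f (i, k) ↔ wordSupport f' (i, k) := fun k => by rw [h]
  have h0 := h' 0
  have h1 := h' 1
  have h2 := h' 2
  simp only [wordSupport, Matrix.cons_val] at h0 h1 h2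
  exact Prod.ext (Bool.eq_iff_iff.2 h0) (Prod.ext (Bool.eq_iff_iff.2 h1) (Bool.eq_iff_iff.2 h2))

theorem mem_faceSpace_kostka {f : Fin r → SignLetter} {x : (Fin r → ℝ) × (Fin r → ℝ)} :
    x ∈ faceSpace (kostkaSpan r) (kostkaForm r) (wordSupport f) ↔ surplus r r x = 0 ∧
      ∀ i : Fin r, ((f i).1 = false → gapFst r i x = 0) ∧
        ((f i).2.1 = false → gapSnd r i x = 0) ∧
        ((f i).2.2 = false → surplus r (i + 1) x = 0) := by
  rw [mem_faceSpace, forall_kostka_index, mem_kostkaSpan]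
  simp [wordSupport]

/-- The gaps counted by the weight are coordinates. They prescribe the second difference of the
surplus wherever it may be nonzero, hence the whole surplus, hence the remaining gaps of mu. -/
theorem finrank_faceSpace_kostka {f : Fin r → SignLetter} (hf : SignAccepted f) :
    Module.finrank ℝ (faceSpace (kostkaSpan r) (kostkaForm r) (wordSupport f)) =
      ∑ i, signWeight (f i) := by
  classical
  obtain ⟨s, hs⟩ := hf
  let T := {i : Fin r // (f i).1 = true} ⊕ {i : Fin r // ((f i).2.1 && (f i).2.2) = true}
  let φ : faceSpace (kostkaSpan r) (kostkaForm r) (wordSupport f) →ₗ[ℝ] (T → ℝ) :=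
    (LinearMap.pi (Sum.elim (fun i => gapFst r i.1) fun i => gapSnd r i.1)) ∘ₗ
      Submodule.subtype _
  have hφ1 : ∀ x i, φ x (Sum.inl i) = gapFst r i.1 x.1 := fun _ _ => rfl
  have hφ2 : ∀ x i, φ x (Sum.inr i) = gapSnd r i.1 x.1 := fun _ _ => rfl
  have hinj : Function.Injective φ := by
    rw [← LinearMap.ker_eq_bot, LinearMap.ker_eq_bot']
    rintro ⟨x, hx⟩ hx0
    have hx' := mem_faceSpace_kostka.1 hx
    have ha : ∀ n < r, gapFst r n x = 0 := fun n hn => by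
      cases h : (f ⟨n, hn⟩).1 with
      | false => exact (hx'.2 ⟨n, hn⟩).1 h
      | true => exact congrFun hx0 (Sum.inl ⟨⟨n, hn⟩, h⟩)
    have hc : ∀ n, surplus r n x = 0 :=
      eq_zero_of_affine_of_ne_zero (R := r) (surplus_zero x)
        (fun n hn => surplus_of_le hn hx'.1) fun n hne => by
          have hn : n < r := by
            by_contra hn
            exact hne (surplus_of_le (by omega) hx'.1)
          rw [← gapSnd_sub_gapFst, ha n hn, sub_zero]
          have hcn : (f ⟨n, hn⟩).2.2 = true := by
            by_contra h
            exact hne ((hx'.2 ⟨n, hn⟩).2.2 (by simpa using h))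
          cases h : (f ⟨n, hn⟩).2.1 with
          | false => exact (hx'.2 ⟨n, hn⟩).2.1 h
          | true => exact congrFun hx0 (Sum.inr ⟨⟨n, hn⟩, by simp [h, hcn]⟩)
    refine Subtype.ext (eq_zero_of_gap_eq_zero ha fun n hn => ?_)
    have := gapSnd_sub_gapFst n x
    rw [ha n hn, hc, hc, hc] at this
    linarith
  have hsurj : Function.Surjective φ := by
    intro y
    let α : ℕ → ℝ := fun n => if h : ∃ hn : n < r, (f ⟨n, hn⟩).1 = true then
      y (Sum.inl ⟨⟨n, h.1⟩, h.2⟩) else 0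
    let β : ℕ → ℝ := fun n => if h : ∃ hn : n < r, ((f ⟨n, hn⟩).2.1 && (f ⟨n, hn⟩).2.2) = true
      then y (Sum.inr ⟨⟨n, h.1⟩, h.2⟩) else 0
    obtain ⟨κ, h0, hoff, hon⟩ := exists_dirichlet_solution r
      (fun n => n < r ∧ (extendWord f n).2.2 = true) (fun n h => h.1) fun n => β n - α n
    -- The gap of mu forced by the identity: it agrees with `β` where the surplus may be positive.
    -- Elsewhere acceptance ensures that it vanishes when the pattern requires it.
    let γ : ℕ → ℝ := fun n => α n + (κ n - 2 * κ (n + 1) + κ (n + 2))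
    have hγ : ∀ n < r, γ n - α n = κ n - 2 * κ (n + 1) + κ (n + 2) := fun n _ => by
      simp only [γ]; ring
    have hr' : κ (r + 1) = 0 := hoff r fun h => lt_irrefl _ h.1
    have hr : κ r = 0 := by
      rcases r with _ | k
      · exact h0
      · refine hoff k fun h => ?_
        exact signStep_state_right _ _ _ (hs.2.2 k h.1) h.2 hs.2.1
    have hA : ∀ n < r, gapFst r n (ofGaps r α γ) = α n := fun n hn => gapFst_ofGaps _ _ hn
    have hB : ∀ n < r, gapSnd r n (ofGaps r α γ) = γ n := fun n hn => gapSnd_ofGaps _ _ hn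
    have hC : ∀ n ≤ r, surplus r n (ofGaps r α γ) = κ n := fun n hn =>
      surplus_ofGaps hγ h0 (hr'.trans hr.symm) hn
    have hα : ∀ i : Fin r, (f i).1 = false → α i = 0 := fun i hi => by simp [α, hi]
    have hγβ : ∀ i : Fin r, (f i).2.2 = true → γ i = β i := fun i hi => by
      simp only [γ]
      rw [hon i ⟨i.2, by rw [extendWord_of_lt f i.2]; exact hi⟩]
      ring
    refine ⟨⟨ofGaps r α γ, mem_faceSpace_kostka.2 ⟨(hC r le_rfl).trans hr,
      fun i => ⟨fun hi => ?_, fun hi => ?_, fun hi => ?_⟩⟩⟩, ?_⟩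
    · rw [hA i i.2, hα i hi]
    · rw [hB i i.2]
      have hstep := hs.2.2 i i.2
      rw [extendWord_of_lt f i.2] at hstep
      cases hc : (f i).2.2 with
      | true => rw [hγβ i hc]; simp [β, hi]
      | false =>
        have ha : (f i).1 = false := by
          by_contra h
          have := signStep_fst _ _ _ hstep hc (by simpa using h)
          rw [hi] at this; simp at this
        have hl : s i = none := by
          by_contra h
          have := signStep_snd_of_left _ _ _ hstep hc h
          rw [hi] at this; simp at this
        have hr : s (i + 1) = none := by
          by_contra h
          have := signStep_snd_of_right _ _ _ hstep hc h
          rw [hi] at this; simp at this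
        have k1 : κ (i + 1) = 0 := hoff i fun h => by
          rw [extendWord_of_lt f i.2, hc] at h
          simp at h
        have k2 : κ (i + 2) = 0 := hoff (i + 1) fun h =>
          signStep_state_left _ _ _ (hs.2.2 _ h.1) h.2 hr
        have k0 : κ i = 0 := by
          rcases hi' : (i : ℕ) with _ | k
          · exact h0
          · refine hoff k fun h => ?_
            rw [hi'] at hl
            exact signStep_state_right _ _ _ (hs.2.2 _ h.1) h.2 hl
        simp only [γ, hα i ha, k0, k1, k2]
        ring
    · rw [hC (i + 1) i.2]
      refine hoff i fun h => ?_
      rw [extendWord_of_lt f i.2, hi] at h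
      simp at h
    · funext t
      rcases t with ⟨i, hi⟩ | ⟨i, hi⟩
      · rw [hφ1]
        refine (hA i i.2).trans ?_
        simp [α, hi]
      · rw [hφ2]
        refine (hB i i.2).trans ?_
        rw [hγβ i (by simpa using (Bool.and_eq_true_iff.1 hi).2)]
        simp only [β]
        rw [dif_pos ⟨i.2, hi⟩]
  rw [(LinearEquiv.ofBijective φ ⟨hinj, hsurj⟩).finrank_eq, Module.finrank_fintype_fun_eq_card,
    Fintype.card_sum, Fintype.card_subtype, Fintype.card_subtype, Finset.card_filter,
    Finset.card_filter, ← Finset.sum_add_distrib]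
  rfl

end FaceDimension

/-! ### Faces as accepted words -/

section FaceClassification

variable {r : ℕ}

theorem IsSignRun.congr {w w' : ℕ → SignLetter} {s : ℕ → Option Bool} (h : IsSignRun r w s)
    (hw : ∀ n < r, w n = w' n) : IsSignRun r w' s :=
  ⟨h.1, h.2.1, fun n hn => hw n hn ▸ h.2.2 n hn⟩

theorem wordSupport_signWord (x : (Fin r → ℝ) × (Fin r → ℝ)) :
    wordSupport (fun i : Fin r => signWord x i) = fun m => 0 < kostkaForm r m x := by
  funext m
  revert m
  rw [forall_kostka_index]
  intro i
  simp [wordSupport, signWord]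

theorem signAccepted_signWord {x : (Fin r → ℝ) × (Fin r → ℝ)}
    (hx : x ∈ polyCone (kostkaSpan r) (kostkaForm r)) :
    SignAccepted fun i : Fin r => signWord x i := by
  obtain ⟨s, hs⟩ := exists_isSignRun_signWord hx
  exact ⟨s, hs.congr fun n hn => by rw [extendWord_of_lt _ hn]⟩

theorem SignsBelow.wordSupport {f : Fin r → SignLetter} {v : (Fin r → ℝ) × (Fin r → ℝ)}
    (h : SignsBelow r (extendWord f) v) (m : Fin r × Fin 3) (hm : 0 < kostkaForm r m v) :
    wordSupport f m := by
  revert m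
  rw [forall_kostka_index]
  intro i
  have := h i i.2
  rw [extendWord_of_lt f i.2] at this
  simpa [_root_.wordSupport] using this

/-- Used twice: for patterns of points it shows that integer points generate the cone; for arbitrary
accepted words it shows that they occur as patterns. -/
theorem SignAccepted.exists_generator {f : Fin r → SignLetter} (hf : SignAccepted f)
    (m : Fin r × Fin 3) (hm : wordSupport f m) :
    ∃ v ∈ kostkaPoints r, 0 < kostkaForm r m v ∧
      ∀ m', 0 < kostkaForm r m' v → wordSupport f m' := by
  obtain ⟨s, hs⟩ := hf
  revert m
  rw [forall_kostka_index]
  intro i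
  have he := extendWord_of_lt f i.2
  refine ⟨fun hm => ?_, fun hm => ?_, fun hm => ?_⟩
  · obtain ⟨v, hv, hsv, hpos⟩ := hs.exists_gapFst_pos i.2 (by rw [he]; simpa [wordSupport] using hm)
    exact ⟨v, hv, hpos, hsv.wordSupport⟩
  · obtain ⟨v, hv, hsv, hpos⟩ := hs.exists_gapSnd_pos i.2 (by rw [he]; simpa [wordSupport] using hm)
    exact ⟨v, hv, hpos, hsv.wordSupport⟩
  · obtain ⟨v, hv, hsv, hpos⟩ :=
      hs.exists_surplus_pos i.2 (by rw [he]; simpa [wordSupport] using hm)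
    exact ⟨v, hv, hpos, hsv.wordSupport⟩

/-- The Kostka cone is given by its inequalities. -/
theorem kostkaCone_eq_polyCone (r : ℕ) :
    kostkaCone r = polyCone (kostkaSpan r) (kostkaForm r) := by
  refine Set.Subset.antisymm
    (convexHull_min kostkaPoints_subset_polyCone polyCone_convex) ?_
  refine polyCone_subset_convexHull zero_mem_kostkaPoints
    (fun n v hv => natCast_smul_mem_kostkaPoints n hv) kostkaPoints_subset_polyCone
    (fun x _ h => ?_) fun x hx m hm => ?_
  · rw [forall_kostka_index] at h
    exact eq_zero_of_gap_eq_zero (fun n hn => (h ⟨n, hn⟩).1) fun n hn => (h ⟨n, hn⟩).2.1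
  · have := (signAccepted_signWord hx).exists_generator m
    rw [wordSupport_signWord] at this
    exact this hm

theorem kostkaPolytope_eq (r : ℕ) : kostkaPolytope r =
    polyCone (kostkaSpan r) (kostkaForm r) ∩ {x | kostkaTotal r x = 1} := by
  rw [kostkaPolytope, kostkaCone_eq_polyCone]
  ext x
  simp [kostkaTotal_apply]

/-- Every accepted word that is not identically zero is the sign pattern of a point of the
polytope. -/
theorem SignAccepted.exists_point {f : Fin r → SignLetter} (hf : SignAccepted f)
    (hpos : 0 < ∑ i, signWeight (f i)) :
    ∃ x ∈ polyCone (kostkaSpan r) (kostkaForm r), kostkaTotal r x = 1 ∧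
      wordSupport f = fun m => 0 < kostkaForm r m x := by
  obtain ⟨x, hx, hsx⟩ := exists_sign_eq (W := kostkaSpan r) (g := kostkaForm r)
    (τ := wordSupport f) fun m hm => by
      obtain ⟨v, hv, h⟩ := hf.exists_generator m hm
      exact ⟨v, kostkaPoints_subset_polyCone hv, h⟩
  have hx0 : x ≠ 0 := by
    rintro rfl
    obtain ⟨i, _, hi⟩ := Finset.exists_ne_zero_of_sum_ne_zero hpos.ne'
    have h0 : ¬ wordSupport f (i, 0) := fun h => by simpa using (hsx _).2 h
    have h1 : ¬ wordSupport f (i, 1) := fun h => by simpa using (hsx _).2 h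
    simp only [wordSupport, Matrix.cons_val] at h0 h1
    simp [signWeight, h0, h1] at hi
  have ht := kostkaTotal_pos hx hx0
  refine ⟨(kostkaTotal r x)⁻¹ • x, polyCone_smul_mem hx (inv_nonneg.2 ht.le), ?_, ?_⟩
  · rw [map_smul, smul_eq_mul, inv_mul_cancel₀ ht.ne']
  · funext m
    rw [map_smul, smul_eq_mul, mul_pos_iff_of_pos_left (inv_pos.2 ht), hsx]

/-- The faces of the Kostka polytope correspond to the accepted sign patterns. -/
theorem kostkaFaces_eq_image (d r : ℕ) : kostkaFaces d r =
    (fun f => sliceFace (kostkaSpan r) (kostkaTotal r) (kostkaForm r) (wordSupport f)) ''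
      {f : Fin r → SignLetter | SignAccepted f ∧ ∑ i, signWeight (f i) = d + 1} := by
  ext F
  constructor
  · rintro ⟨hne, hexp, hdim⟩
    rw [kostkaPolytope_eq] at hexp
    obtain ⟨x, hx, hx1, rfl⟩ := exists_eq_sliceFace hne hexp
    refine ⟨fun i => signWord x i, ⟨signAccepted_signWord hx, ?_⟩, ?_⟩
    · rw [← finrank_faceSpace_kostka (signAccepted_signWord hx), wordSupport_signWord,
        ← finrank_vectorSpan_sliceFace hx hx1, hdim]
    · simp only [wordSupport_signWord]
  · rintro ⟨f, ⟨hf, hw⟩, rfl⟩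
    obtain ⟨x, hx, hx1, hfx⟩ := hf.exists_point (by omega)
    refine ⟨⟨x, ⟨hx, hx1⟩, fun m hm => ?_⟩, ?_, ?_⟩
    · rw [hfx] at hm
      exact le_antisymm (not_lt.1 hm) (hx.2 m)
    · rw [kostkaPolytope_eq]
      exact isExposed_sliceFace _
    · have h := finrank_faceSpace_kostka hf
      beta_reduce
      rw [hfx] at h ⊢
      rw [← finrank_vectorSpan_sliceFace hx hx1] at h
      omega

theorem kostkaFaces_finite (d r : ℕ) : (kostkaFaces d r).Finite := by
  rw [kostkaFaces_eq_image]
  exact (Set.toFinite _).image _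

theorem kostkaFaceNumber_eq_ncard (d r : ℕ) : kostkaFaceNumber d r =
    {f : Fin r → SignLetter | SignAccepted f ∧ ∑ i, signWeight (f i) = d + 1}.ncard := by
  rw [kostkaFaceNumber, kostkaFaces_eq_image]
  refine Set.InjOn.ncard_image ?_
  rintro f ⟨hf, hw⟩ f' ⟨hf', hw'⟩ h
  obtain ⟨x, hx, hx1, hfx⟩ := hf.exists_point (by omega)
  obtain ⟨y, hy, hy1, hfy⟩ := hf'.exists_point (by omega)
  refine wordSupport_injective ?_
  beta_reduce at h
  rw [hfx, hfy] at h ⊢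
  funext m
  exact propext (sliceFace_sign_injOn hx hy hx1 hy1 h m)

end FaceClassification

/-! ### Counting accepted words -/

section Counting

/-- Acceptance of a finite word from the state `e`. -/
def AcceptedFrom : (r : ℕ) → Option Bool → (Fin r → SignLetter) → Prop
  | 0, e, _ => e = none
  | r + 1, e, f => ∃ e', signStep e (f 0) e' ∧ AcceptedFrom r e' (Fin.tail f)

theorem acceptedFrom_iff {r : ℕ} {e : Option Bool} {f : Fin r → SignLetter} :
    AcceptedFrom r e f ↔ ∃ s : ℕ → Option Bool, s 0 = e ∧ s r = none ∧
      ∀ n < r, signStep (s n) (extendWord f n) (s (n + 1)) := by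
  induction r generalizing e with
  | zero =>
    constructor
    · intro h
      exact ⟨fun _ => e, rfl, h, fun n hn => by omega⟩
    · rintro ⟨s, h1, h2, _⟩
      exact h1.symm.trans h2
  | succ r ih =>
    have htail : ∀ n < r, extendWord (Fin.tail f) n = extendWord f (n + 1) := fun n hn => by
      rw [extendWord_of_lt _ hn, extendWord_of_lt _ (Nat.succ_lt_succ hn)]
      rfl
    constructor
    · rintro ⟨e', he', hacc⟩
      obtain ⟨s, h1, h2, h3⟩ := ih.1 hacc
      refine ⟨fun n => Nat.casesOn n e s, rfl, h2, fun n hn => ?_⟩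
      rcases n with _ | n
      · rw [extendWord_of_lt _ hn]
        change signStep e (f 0) (s 0)
        rwa [h1]
      · have := h3 n (by omega)
        rwa [htail n (by omega)] at this
    · rintro ⟨s, h1, h2, h3⟩
      refine ⟨s 1, ?_, ih.2 ⟨fun n => s (n + 1), rfl, h2, fun n hn => ?_⟩⟩
      · have := h3 0 (Nat.succ_pos r)
        rwa [h1, extendWord_of_lt _ (Nat.succ_pos r)] at this
      · rw [htail n hn]
        exact h3 (n + 1) (by omega)

theorem signAccepted_iff {r : ℕ} {f : Fin r → SignLetter} :
    SignAccepted f ↔ AcceptedFrom r none f ∨ AcceptedFrom r (some false) f := by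
  rw [acceptedFrom_iff, acceptedFrom_iff]
  constructor
  · rintro ⟨s, h0, h1, h2⟩
    match hs : s 0 with
    | none => exact Or.inl ⟨s, hs, h1, h2⟩
    | some false => exact Or.inr ⟨s, hs, h1, h2⟩
    | some true => exact (h0 hs).elim
  · rintro (⟨s, h0, h1, h2⟩ | ⟨s, h0, h1, h2⟩)
    · exact ⟨s, by simp [h0], h1, h2⟩
    · exact ⟨s, by simp [h0], h1, h2⟩

/-- The first letter tells the two states apart: a positive surplus excludes `none`, a zero surplus
excludes `some false`. -/
theorem not_acceptedFrom_none_and_fresh {r : ℕ} {f : Fin r → SignLetter}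
    (h : AcceptedFrom r none f) (h' : AcceptedFrom r (some false) f) : False := by
  rcases r with _ | r
  · simp [AcceptedFrom] at h'
  · obtain ⟨e, he, _⟩ := h
    obtain ⟨e', he', _⟩ := h'
    have : ∀ l e e', signStep none l e → ¬ signStep (some false) l e' := by decide
    exact this _ _ _ he he'

/-- The automaton is unambiguous, so words may be counted by runs: its only choice, whether a new
run starts, is settled by the rest of the word. -/
theorem AcceptedFrom.state_unique {r : ℕ} {f : Fin r → SignLetter} {e e₁ e₂ : Option Bool}
    {l : SignLetter} (h₁ : signStep e l e₁) (h₂ : signStep e l e₂)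
    (hf₁ : AcceptedFrom r e₁ f) (hf₂ : AcceptedFrom r e₂ f) : e₁ = e₂ := by
  have : ∀ e l e₁ e₂, signStep e l e₁ → signStep e l e₂ →
      e₁ = e₂ ∨ (e₁ = none ∧ e₂ = some false) ∨ (e₁ = some false ∧ e₂ = none) := by decide
  rcases this e l e₁ e₂ h₁ h₂ with h | ⟨rfl, rfl⟩ | ⟨rfl, rfl⟩
  · exact h
  · exact (not_acceptedFrom_none_and_fresh hf₁ hf₂).elim
  · exact (not_acceptedFrom_none_and_fresh hf₂ hf₁).elim

open Classical in
/-- The number of words of length `r` and weight `w` that are accepted from the state `e`. -/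
noncomputable def signCount (r : ℕ) (e : Option Bool) (w : ℤ) : ℕ :=
  (Finset.univ.filter fun f : Fin r → SignLetter =>
    AcceptedFrom r e f ∧ (∑ i, (signWeight (f i) : ℤ)) = w).card

theorem ncard_signAccepted (r n : ℕ) :
    {f : Fin r → SignLetter | SignAccepted f ∧ ∑ i, signWeight (f i) = n}.ncard =
      signCount r none n + signCount r (some false) n := by
  classical
  rw [signCount, signCount, ← Finset.card_union_of_disjoint, ← Set.ncard_coe_finset]
  · congr 1
    ext f
    simp only [Set.mem_ofPred_eq, Finset.coe_union, Finset.coe_filter, Finset.mem_univ, true_and,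
      Set.mem_union, signAccepted_iff, ← or_and_right]
    norm_cast
  · rw [Finset.disjoint_filter]
    rintro f _ ⟨h, _⟩ ⟨h', _⟩
    exact not_acceptedFrom_none_and_fresh h h'

theorem signCount_zero (e : Option Bool) (w : ℤ) :
    signCount 0 e w = if e = none ∧ w = 0 then 1 else 0 := by
  classical
  rw [signCount, Finset.card_filter, Fintype.sum_unique]
  simp [AcceptedFrom, eq_comm]

theorem signCount_succ (r : ℕ) (e : Option Bool) (w : ℤ) :
    signCount (r + 1) e w = ∑ l, ∑ e', if signStep e l e' then
      signCount r e' (w - signWeight l) else 0 := by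
  classical
  have h1 : signCount (r + 1) e w = ∑ l : SignLetter, ∑ f : Fin r → SignLetter,
      if AcceptedFrom (r + 1) e (Fin.cons l f : Fin (r + 1) → SignLetter) ∧
        (∑ i, (signWeight ((Fin.cons l f : Fin (r + 1) → SignLetter) i) : ℤ)) = w
        then 1 else 0 := by
    rw [signCount, Finset.card_filter, ← Fintype.sum_prod_type']
    exact (Fintype.sum_equiv (Fin.consEquiv fun _ => SignLetter) _ _ fun _ => rfl).symm
  rw [h1]
  refine Finset.sum_congr rfl fun l _ => ?_
  have h2 : ∀ e', (if signStep e l e' then signCount r e' (w - signWeight l) else 0) =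
      ∑ f : Fin r → SignLetter, if signStep e l e' ∧ AcceptedFrom r e' f ∧
        (∑ i, (signWeight (f i) : ℤ)) = w - signWeight l then 1 else 0 := fun e' => by
    split_ifs with h
    · rw [signCount, Finset.card_filter]
      exact Finset.sum_congr rfl fun f _ => by simp [h]
    · exact (Finset.sum_eq_zero fun f _ => if_neg fun h' => h h'.1).symm
  rw [Finset.sum_congr rfl fun e' _ => h2 e', Finset.sum_comm]
  refine Finset.sum_congr rfl fun f _ => ?_
  have h3 : (∑ i, (signWeight ((Fin.cons l f : Fin (r + 1) → SignLetter) i) : ℤ)) = w ↔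
      (∑ i, (signWeight (f i) : ℤ)) = w - signWeight l := by
    rw [Fin.sum_univ_succ]
    simp only [Fin.cons_zero, Fin.cons_succ]
    omega
  simp only [h3, AcceptedFrom, Fin.cons_zero, Fin.tail_cons]
  split_ifs with h
  · obtain ⟨⟨e', he', hacc⟩, hw⟩ := h
    rw [Finset.sum_eq_single e']
    · rw [if_pos ⟨he', hacc, hw⟩]
    · rintro e'' _ hne
      exact if_neg fun h => hne (AcceptedFrom.state_unique h.1 he' h.2.1 hacc)
    · simp
  · refine (Finset.sum_eq_zero fun e' _ => if_neg fun h' => h ⟨⟨e', h'.1, h'.2.1⟩, h'.2.2⟩).symm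

/-- Summation over the transitions from `e` that read a letter with a positive gap. -/
def essentialSum (X : Option Bool → ℤ → ℕ) (e : Option Bool) (w : ℤ) : ℕ :=
  ∑ l : SignLetter, ∑ e', if signStep e l e' ∧ (l.1 || l.2.1) then X e' (w - signWeight l) else 0

/-- The number of words of length `k` and weight `w` without a letter having both gaps zero that
are accepted from `e`. -/
def essentialCount : ℕ → Option Bool → ℤ → ℕ
  | 0, e, w => if e = none ∧ w = 0 then 1 else 0
  | k + 1, e, w => essentialSum (essentialCount k) e w

theorem essentialSum_none (X : Option Bool → ℤ → ℕ) (w : ℤ) : essentialSum X none w =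
    X (some false) w + X none (w - 1) + X (some false) (w - 1) := by
  simp [essentialSum, Fintype.sum_prod_type, Fintype.sum_option, signStep, signWeight]
  ring

theorem essentialSum_fresh (X : Option Bool → ℤ → ℕ) (w : ℤ) : essentialSum X (some false) w =
    X (some false) (w - 1) + X (some true) (w - 1) + X (some true) (w - 2) := by
  simp [essentialSum, Fintype.sum_prod_type, Fintype.sum_option, signStep, signWeight]
  ring

theorem essentialSum_peaked (X : Option Bool → ℤ → ℕ) (w : ℤ) : essentialSum X (some true) w =
    X none w + X (some false) w + X none (w - 1) + X (some false) (w - 1) +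
      2 * X (some true) (w - 1) + X (some true) (w - 2) := by
  simp [essentialSum, Fintype.sum_prod_type, Fintype.sum_option, signStep, signWeight]
  ring

/-- The letter with both gaps zero can be read in every state, in exactly one way and without
changing the state. -/
theorem sum_signStep (X : Option Bool → ℤ → ℕ) (e : Option Bool) (w : ℤ) :
    (∑ l, ∑ e', if signStep e l e' then X e' (w - signWeight l) else 0) =
      X e w + essentialSum X e w := by
  rcases e with _ | _ | _ <;>
  · simp [essentialSum, Fintype.sum_prod_type, Fintype.sum_option, signStep, signWeight]
    ring

theorem essentialSum_sum {κ : Type*} (S : Finset κ) (a : κ → ℕ)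
    (F : κ → Option Bool → ℤ → ℕ) (e : Option Bool) (w : ℤ) :
    essentialSum (fun e w => ∑ k ∈ S, a k * F k e w) e w =
      ∑ k ∈ S, a k * essentialSum (F k) e w := by
  rcases e with _ | _ | _
  · simp only [essentialSum_none, mul_add, Finset.sum_add_distrib]
  · simp only [essentialSum_fresh, mul_add, Finset.sum_add_distrib]
  · simp only [essentialSum_peaked, mul_add, Finset.sum_add_distrib, Finset.mul_sum,
      mul_left_comm]

theorem sum_range_choose_succ (r : ℕ) (F : ℕ → ℕ) :
    ∑ k ∈ Finset.range (r + 2), (r + 1).choose k * F k =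
      ∑ k ∈ Finset.range (r + 1), r.choose k * F k +
        ∑ k ∈ Finset.range (r + 1), r.choose k * F (k + 1) := by
  have h : ∑ k ∈ Finset.range (r + 1), r.choose k * F k =
      ∑ k ∈ Finset.range (r + 2), r.choose k * F k := by
    rw [Finset.sum_range_succ _ (r + 1), Nat.choose_succ_self, zero_mul, add_zero]
  rw [h, Finset.sum_range_succ', Finset.sum_range_succ' (fun k => r.choose k * F k)]
  simp only [Nat.choose_succ_succ, add_mul, Finset.sum_add_distrib, Nat.choose_zero_right]
  ring

/-- Pascal's rule: the first letter either has both gaps zero and changes nothing, or is one of the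
`k` chosen letters. -/
theorem signCount_eq_sum (r : ℕ) (e : Option Bool) (w : ℤ) :
    signCount r e w = ∑ k ∈ Finset.range (r + 1), r.choose k * essentialCount k e w := by
  induction r generalizing e w with
  | zero => simp [signCount_zero, essentialCount]
  | succ r ih =>
    rw [signCount_succ, sum_signStep, sum_range_choose_succ, ← ih]
    congr 1
    have : signCount r =
        fun e w => ∑ k ∈ Finset.range (r + 1), r.choose k * essentialCount k e w :=
      funext fun e => funext fun w => ih e w
    rw [this, essentialSum_sum]
    rfl

theorem essentialCount_succ_none (k : ℕ) (w : ℤ) : essentialCount (k + 1) none w =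
    essentialCount k (some false) w + essentialCount k none (w - 1) +
      essentialCount k (some false) (w - 1) :=
  essentialSum_none _ w

theorem essentialCount_succ_fresh (k : ℕ) (w : ℤ) : essentialCount (k + 1) (some false) w =
    essentialCount k (some false) (w - 1) + essentialCount k (some true) (w - 1) +
      essentialCount k (some true) (w - 2) :=
  essentialSum_fresh _ w

theorem essentialCount_succ_peaked (k : ℕ) (w : ℤ) : essentialCount (k + 1) (some true) w =
    essentialCount k none w + essentialCount k (some false) w +
      essentialCount k none (w - 1) + essentialCount k (some false) (w - 1) +
      2 * essentialCount k (some true) (w - 1) + essentialCount k (some true) (w - 2) :=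
  essentialSum_peaked _ w

theorem essentialCount_zero_none (w : ℤ) :
    essentialCount 0 none w = if w = 0 then 1 else 0 := by
  simp [essentialCount]

theorem essentialCount_zero_some (b : Bool) (w : ℤ) : essentialCount 0 (some b) w = 0 := by
  simp [essentialCount]

/-- Every unit of weight allows for at most three letters. -/
theorem essentialCount_eq_zero_of_long (k : ℕ) :
    (∀ w : ℤ, 3 * w < k → essentialCount k none w = 0) ∧
    (∀ w : ℤ, 3 * w - 1 < k → essentialCount k (some false) w = 0) ∧
    (∀ w : ℤ, 3 * w + 1 < k → essentialCount k (some true) w = 0) := by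
  -- The offsets 0, -1, +1 of the three states are a potential that pays for weightless letters. The
  -- cycle `some true`, `none`, `some false` can read three letters at the cost of one unit.
  induction k with
  | zero =>
    refine ⟨fun w hw => ?_, fun w _ => essentialCount_zero_some _ w,
      fun w _ => essentialCount_zero_some _ w⟩
    rw [essentialCount_zero_none, if_neg]
    omega
  | succ k ih =>
    obtain ⟨h1, h2, h3⟩ := ih
    refine ⟨fun w hw => ?_, fun w hw => ?_, fun w hw => ?_⟩
    · rw [essentialCount_succ_none, h1 _ (by omega), h2 _ (by omega), h2 _ (by omega)]
    · rw [essentialCount_succ_fresh, h2 _ (by omega), h3 _ (by omega), h3 _ (by omega)]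
    · rw [essentialCount_succ_peaked, h1 _ (by omega), h1 _ (by omega), h2 _ (by omega),
        h2 _ (by omega), h3 _ (by omega), h3 _ (by omega)]

/-- A letter has weight at most two, and the last one has weight at most one. -/
theorem essentialCount_eq_zero_of_heavy (k : ℕ) :
    (∀ w : ℤ, 1 ≤ w → 2 * k ≤ w → essentialCount k none w = 0) ∧
    (∀ b, ∀ w : ℤ, 2 * k ≤ w → essentialCount k (some b) w = 0) := by
  induction k with
  | zero =>
    refine ⟨fun w hw _ => ?_, fun b w _ => essentialCount_zero_some _ w⟩
    rw [essentialCount_zero_none, if_neg]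
    omega
  | succ k ih =>
    obtain ⟨h1, h2⟩ := ih
    refine ⟨fun w hw hk => ?_, fun b w hk => ?_⟩
    · rw [essentialCount_succ_none, h1 _ (by omega) (by omega), h2 _ _ (by omega),
        h2 _ _ (by omega)]
    · cases b
      · rw [essentialCount_succ_fresh, h2 _ _ (by omega), h2 _ _ (by omega), h2 _ _ (by omega)]
      · rw [essentialCount_succ_peaked, h1 _ (by omega) (by omega), h1 _ (by omega) (by omega),
          h2 _ _ (by omega), h2 _ _ (by omega), h2 _ _ (by omega), h2 _ _ (by omega)]

/-- The only such word has `m` letters of weight two, followed by a closing letter of weight one. -/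
theorem essentialCount_peaked_top (m : ℕ) :
    essentialCount (m + 1) (some true) (2 * m + 1) = 1 := by
  induction m with
  | zero =>
    rw [essentialCount_succ_peaked]
    simp [essentialCount_zero_none, essentialCount_zero_some]
  | succ m ih =>
    obtain ⟨h1, h2⟩ := essentialCount_eq_zero_of_heavy (m + 1)
    rw [essentialCount_succ_peaked, h1 _ (by omega) (by omega), h1 _ (by omega) (by omega),
      h2 _ _ (by omega), h2 _ _ (by omega), h2 _ _ (by omega)]
    convert ih using 2
    simp only [Nat.cast_add, Nat.cast_one]
    ring_nf

/-- The same word as from `some true`. It starts in `none` if it is the closing letter alone, and in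
`some false` otherwise. -/
theorem essentialCount_none_add_fresh_top (m : ℕ) :
    essentialCount (m + 1) none (2 * m + 1) + essentialCount (m + 1) (some false) (2 * m + 1) =
      1 := by
  rw [essentialCount_succ_none, essentialCount_succ_fresh]
  rcases m with _ | m
  · simp [essentialCount_zero_none, essentialCount_zero_some]
  · obtain ⟨h1, h2⟩ := essentialCount_eq_zero_of_heavy (m + 1)
    rw [h1 _ (by omega) (by omega), h2 _ _ (by omega), h2 _ _ (by omega), h2 _ _ (by omega)]
    have := essentialCount_peaked_top m
    rw [show (2 * ((m + 1 : ℕ) : ℤ) + 1 - 2) = 2 * m + 1 by push_cast; ring]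
    omega

/-- One unit below the maximum. Each additional letter gives three new words, in which the first
letter has weight one: two inside the run and one closing it. -/
theorem essentialCount_peaked_subtop (m : ℕ) :
    essentialCount (m + 1) (some true) (2 * m) = 3 * m + 1 := by
  induction m with
  | zero =>
    rw [essentialCount_succ_peaked]
    simp [essentialCount_zero_none, essentialCount_zero_some]
  | succ m ih =>
    obtain ⟨h1, h2⟩ := essentialCount_eq_zero_of_heavy (m + 1)
    have h3 := essentialCount_none_add_fresh_top m
    have h4 := essentialCount_peaked_top m
    rw [essentialCount_succ_peaked, h1 _ (by omega) (by omega), h2 _ _ (by omega),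
      show (2 * ((m + 1 : ℕ) : ℤ) - 1) = 2 * m + 1 by push_cast; ring,
      show (2 * ((m + 1 : ℕ) : ℤ) - 2) = 2 * m by push_cast; ring, ih]
    omega

theorem essentialCount_none_add_fresh_subtop (m : ℕ) :
    essentialCount (m + 2) none (2 * m + 2) + essentialCount (m + 2) (some false) (2 * m + 2) =
      if m = 0 then 3 else 3 * m + 4 := by
  have h1 := (essentialCount_eq_zero_of_heavy (m + 1)).2 false (2 * m + 2) (by push_cast; omega)
  have h2 := essentialCount_none_add_fresh_top m
  have h3 := essentialCount_peaked_top m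
  have h4 := essentialCount_peaked_subtop m
  change essentialCount (m + 1 + 1) none _ + essentialCount (m + 1 + 1) (some false) _ = _
  rw [essentialCount_succ_none, essentialCount_succ_fresh (m + 1), h1,
    show (2 * (m : ℤ) + 2 - 1) = 2 * m + 1 by ring, show (2 * (m : ℤ) + 2 - 2) = 2 * m by ring,
    h3, h4]
  -- From `some false` a single letter cannot close the run, which still lacks a peak. This is why
  -- `d = 1` is exceptional.
  have h5 : essentialCount (m + 1) (some false) (2 * m + 1) = if m = 0 then 0 else 1 := by
    rw [essentialCount_succ_fresh]
    rcases m with _ | m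
    · simp [essentialCount_zero_some]
    · obtain ⟨_, h6⟩ := essentialCount_eq_zero_of_heavy (m + 1)
      rw [h6 _ _ (by omega), h6 _ _ (by omega),
        show (2 * ((m + 1 : ℕ) : ℤ) + 1 - 2) = 2 * m + 1 by push_cast; ring,
        essentialCount_peaked_top m]
      simp
  split_ifs at h5 ⊢ with hm
  · omega
  · omega

/-- The coefficients of the face numbers in the binomial basis. -/
def faceCoefficient (d k : ℕ) : ℕ :=
  essentialCount k none (d + 1) + essentialCount k (some false) (d + 1)

theorem faceCoefficient_eq_zero {d k : ℕ} (hk : k ∉ Finset.Icc ((d + 3) / 2) (3 * d + 3)) :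
    faceCoefficient d k = 0 := by
  rw [Finset.mem_Icc, not_and_or, not_le, not_le] at hk
  rcases hk with hk | hk
  · obtain ⟨h1, h2⟩ := essentialCount_eq_zero_of_heavy k
    rw [faceCoefficient, h1 _ (by omega) (by omega), h2 _ _ (by omega)]
  · obtain ⟨h1, h2, _⟩ := essentialCount_eq_zero_of_long k
    rw [faceCoefficient, h1 _ (by omega), h2 _ (by omega)]

theorem kostkaFaceNumber_eq_sum (d r : ℕ) : kostkaFaceNumber d r =
    ∑ k ∈ Finset.Icc ((d + 3) / 2) (3 * d + 3), faceCoefficient d k * r.choose k := by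
  have h : kostkaFaceNumber d r =
      ∑ k ∈ Finset.range (r + 1), faceCoefficient d k * r.choose k := by
    rw [kostkaFaceNumber_eq_ncard, ncard_signAccepted, signCount_eq_sum, signCount_eq_sum,
      ← Finset.sum_add_distrib]
    refine Finset.sum_congr rfl fun k _ => ?_
    rw [faceCoefficient]
    push_cast
    ring
  -- Both index ranges are enlarged to their union: outside one the binomial vanishes, outside the
  -- other the coefficient does.
  rw [h, Finset.sum_subset
      (Finset.subset_union_left (s₂ := Finset.Icc ((d + 3) / 2) (3 * d + 3))),
    ← Finset.sum_subset (Finset.subset_union_right (s₁ := Finset.range (r + 1)))]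
  · intro k _ hk
    rw [faceCoefficient_eq_zero hk, zero_mul]
  · intro k _ hk
    rw [Nat.choose_eq_zero_of_lt (by simpa using hk), mul_zero]

end Counting

/-! ### Polynomiality, recursion and initial values -/

theorem theorem5p3 (d : ℕ) :
    -- the face numbers are genuine (finite) counts
    (∀ r : ℕ, (kostkaFaces d r).Finite) ∧
    -- `f_d` is a polynomial function of degree at most `3d + 3`
    (∃ p : Polynomial ℚ, p.natDegree ≤ 3 * d + 3 ∧
      ∀ r : ℕ, (kostkaFaceNumber d r : ℚ) = p.eval (r : ℚ)) ∧
    -- with nonnegative integer coefficients in the binomial basis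
    (∃ α : ℕ → ℕ,
      (∀ r : ℕ, kostkaFaceNumber d r =
        ∑ k ∈ Finset.Icc ((d + 3) / 2) (3 * d + 3), α k * r.choose k) ∧
      (∀ k ∈ Finset.Ioc ((d + 3) / 2) (3 * d + 3),
        (α k : ℤ) = (kostkaFaceNumber d k : ℤ) -
          ∑ j ∈ Finset.Ico ((d + 3) / 2) k, (k.choose j : ℤ) * (α j : ℤ)) ∧
      α ((d + 3) / 2) = kostkaFaceNumber d ((d + 3) / 2) ∧
      (Odd d → 1 < d → α ((d + 3) / 2) = 3 * ((d + 3) / 2) - 2) ∧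
      (Even d → α ((d + 3) / 2) = 1) ∧
      (d = 1 → α ((d + 3) / 2) = 3)) := by
  -- At `r = k` the binomial expansion is triangular with diagonal entry one, which gives the
  -- recursion.
  have hself : ∀ k ∈ Finset.Icc ((d + 3) / 2) (3 * d + 3), kostkaFaceNumber d k =
      ∑ j ∈ Finset.Ico ((d + 3) / 2) k, k.choose j * faceCoefficient d j +
        faceCoefficient d k := by
    intro k hk
    rw [Finset.mem_Icc] at hk
    rw [kostkaFaceNumber_eq_sum, ← Finset.sum_subset (s₁ := Finset.Icc ((d + 3) / 2) k)
      (Finset.Icc_subset_Icc_right hk.2), ← Finset.Ico_insert_right hk.1,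
      Finset.sum_insert (by simp), Nat.choose_self, mul_one, add_comm]
    · exact congrArg (· + _) (Finset.sum_congr rfl fun j _ => mul_comm _ _)
    · intro j hj hj'
      rw [Finset.mem_Icc] at hj hj'
      rw [Nat.choose_eq_zero_of_lt (by omega), mul_zero]
  have hodd : ∀ m, d = 2 * m + 1 → faceCoefficient d ((d + 3) / 2) =
      if m = 0 then 3 else 3 * m + 4 := by
    rintro m rfl
    rw [show (2 * m + 1 + 3) / 2 = m + 2 by omega, ← essentialCount_none_add_fresh_subtop,
      faceCoefficient, show (((2 * m + 1 : ℕ) : ℤ) + 1) = 2 * m + 2 by push_cast; ring]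
  refine ⟨kostkaFaces_finite d, ⟨∑ k ∈ Finset.Icc ((d + 3) / 2) (3 * d + 3),
    Polynomial.C ((faceCoefficient d k : ℚ) / k.factorial) * descPochhammer ℚ k, ?_, ?_⟩,
    faceCoefficient d, kostkaFaceNumber_eq_sum d, ?_, ?_, ?_, ?_, ?_⟩
  · refine Polynomial.natDegree_sum_le_of_forall_le _ _ fun k hk => ?_
    refine (Polynomial.natDegree_C_mul_le _ _).trans ?_
    rw [descPochhammer_natDegree]
    exact (Finset.mem_Icc.1 hk).2
  · intro r
    rw [kostkaFaceNumber_eq_sum, Polynomial.eval_finsetSum]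
    push_cast
    refine Finset.sum_congr rfl fun k _ => ?_
    rw [Polynomial.eval_mul, Polynomial.eval_C, Nat.cast_choose_eq_descPochhammer_div]
    ring
  · intro k hk
    rw [hself k (Finset.Ioc_subset_Icc_self hk)]
    push_cast
    ring
  · rw [hself _ (Finset.left_mem_Icc.2 (by omega))]
    simp
  · rintro ⟨m, rfl⟩ hd
    rw [hodd m rfl, if_neg (by omega)]
    omega
  · rintro ⟨m, rfl⟩
    rw [show (m + m + 3) / 2 = m + 1 by omega, faceCoefficient,
      show (((m + m : ℕ) : ℤ) + 1) = 2 * m + 1 by push_cast; ring]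
    exact essentialCount_none_add_fresh_top m
  · intro hd
    rw [hodd 0 (by omega), if_pos rfl]
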